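/- A domain is a nonempty connected open subset of $\mathbb{C}$, and $dA$ is area measure. For a domain $D$, an admissible weight, $\mu\in AW(D)$, is a positive measurable function $\mu$ on $D$ such that the space $A^2_\mu(D)$ of holomorphic functions $f$ on $D$ with $\int_D|f|^2\mu\,dA<\infty$ is closed in $L^2_\mu(D)$ and the evaluations $A^2_\mu(D)\ni f\mapsto f(z)$, $z\in D$, are continuous. For $n\ge 1$ and $\zeta\in D$ let $AD^\mu(D,\zeta^n)$ be the space of holomorphic $f$ on $D$ with $f(\zeta)=f'(\zeta)=\dots=f^{(n-1)}(\zeta)=0$ and $\int_D|f'|^2\mu\,dA<\infty$, with inner product $\langle f,g\rangle=\int_D f'\,\overline{g'}\,\mu\,dA$. For every domain $D$, $\mu\in AW(D)$, $n\ge1$ and $\zeta\in D$ there is a unique $M_{D,\mu,n}(\cdot,\zeta)\in AD^\mu(D,\zeta^n)$ with $f^{(n)}(\zeta)=\langle f,M_{D,\mu,n}(\cdot,\zeta)\rangle$ for all $f\in AD^\mu(D,\zeta^n)$ (the $n$-th order kernel function). Put $\tilde K_{D,\mu}(z,\zeta)=\frac{\partial}{\partial z}M_{D,\mu,1}(z,\zeta)$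 and $N_D(\mu)=\{z\in D:\tilde K_{D,\mu}(z,z)=0\}$. Let $(D_i)_{i\ge1}$ be a sequence of domains with $\mu_i\in AW(D_i)$. (1) Let $D=\bigcup_i D_i$ and $\mu\in AW(D)$. Suppose that for every $i$ there is a $j(i)$ such that $D_i\subset D_k$ and $\mu_i(z)\le\mu_k(z)\le\mu(z)$ for all $k\ge j(i)$ and $z\in D_i$, and that $\mu_i\to\mu$ pointwise a.e. on $D$. Then for all $n\ge1$ and all $\xi\in D$, $M_{D_i,\mu_i,n}(\cdot,\xi)\to M_{D,\mu,n}(\cdot,\xi)$ locally uniformly on $D$. (2) Suppose that $D=\bigcap_i D_i$ is a domain, $\mu\in AW(D)$, $\mu\le\mu_i$ on $D$ for all $i$, $\mu_i\to\mu$ pointwise a.e. on $D$, and $\tilde K_{D_i,\mu_i}(t,t)\to\tilde K_{D,\mu}(t,t)$ for every $t\in D$. Then (a) for all $\xi\in D$, $M_{D_i,\mu_i,1}(\cdot,\xi)\to M_{D,\mu,1}(\cdot,\xi)$ locally uniformly on $D$; (b) for all $n>1$ and all $\xi\in D\setminus N_D(\mu)$, $M_{D_i,\mu_i,n}(\cdot,\xi)\to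 M_{D,\mu,n}(\cdot,\xi)$ locally uniformly on $D$. -/

import Mathlib

open MeasureTheory Filter Topology

namespace ReducedBergman

/-- A domain in the complex plane: a nonempty connected open set. -/
def IsPlanarDomain (D : Set ℂ) : Prop := IsOpen D ∧ IsConnected D

/-- The measure `μ dA` on `D`, so that `Lp ℂ 2 (weightedArea D μ)` is the space `L²_μ(D)`. -/
noncomputable def weightedArea (D : Set ℂ) (μ : ℂ → ℝ) : Measure ℂ :=
  (volume.restrict D).withDensity (fun z => ENNReal.ofReal (μ z))

/-- The weighted Bergman space `A²_μ(D)`. Only the values of its elements on `D` matter. -/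
def bergmanSpace (D : Set ℂ) (μ : ℂ → ℝ) : Set (ℂ → ℂ) :=
  {f | DifferentiableOn ℂ f D ∧ IntegrableOn (fun z => ‖f z‖ ^ 2 * μ z) D}

/-- Admissible weights on `D`: positive measurable functions `μ` on `D` such that `A²_μ(D)` is
closed in `L²_μ(D)` and all point evaluations on `A²_μ(D)` are continuous (that is, bounded). -/
structure AdmissibleWeight (D : Set ℂ) (μ : ℂ → ℝ) : Prop where
  measurable : AEMeasurable μ (volume.restrict D)
  pos : ∀ z ∈ D, 0 < μ z
  isClosed : IsClosed {g : Lp ℂ 2 (weightedArea D μ) |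
    ∃ f ∈ bergmanSpace D μ, (g : ℂ → ℂ) =ᵐ[weightedArea D μ] f}
  evaluation : ∀ z ∈ D, ∃ C : ℝ, ∀ f ∈ bergmanSpace D μ,
    ‖f z‖ ≤ C * Real.sqrt (∫ x in D, ‖f x‖ ^ 2 * μ x)

/-- The space `AD^μ(D, ζⁿ)`: holomorphic functions on `D` that vanish at `ζ` together with their
derivatives of order less than `n`, and whose derivative is square integrable against `μ`. -/
def adSpace (D : Set ℂ) (μ : ℂ → ℝ) (n : ℕ) (ζ : ℂ) : Set (ℂ → ℂ) :=
  {f | DifferentiableOn ℂ f D ∧ (∀ k < n, iteratedDeriv k f ζ = 0) ∧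
    IntegrableOn (fun z => ‖deriv f z‖ ^ 2 * μ z) D}

/-- The inner product of `AD^μ(D, ζⁿ)`, linear in the first argument. -/
noncomputable def adInner (D : Set ℂ) (μ : ℂ → ℝ) (f g : ℂ → ℂ) : ℂ :=
  ∫ z in D, deriv f z * starRingEnd ℂ (deriv g z) * (μ z : ℂ)

/-- `M` lies in `AD^μ(D, ζⁿ)` and represents the functional `f ↦ f⁽ⁿ⁾(ζ)` there. -/
def IsKernelFunction (D : Set ℂ) (μ : ℂ → ℝ) (n : ℕ) (ζ : ℂ) (M : ℂ → ℂ) : Prop :=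
  M ∈ adSpace D μ n ζ ∧ ∀ f ∈ adSpace D μ n ζ, iteratedDeriv n f ζ = adInner D μ f M

open Classical in
/-- The `n`-th order kernel function `M_{D,μ,n}(·, ζ)`, as a function of its first variable.
It is determined on `D`; its values off `D` are irrelevant. -/
noncomputable def kernelM (D : Set ℂ) (μ : ℂ → ℝ) (n : ℕ) (ζ : ℂ) : ℂ → ℂ :=
  if h : ∃ M, IsKernelFunction D μ n ζ M then h.choose else 0

/-- The `n`-th order weighted reduced Bergman kernel `∂/∂z M_{D,μ,n}(z, ζ)`. -/
noncomputable def reducedKernel (D : Set ℂ) (μ : ℂ → ℝ) (n : ℕ) (z ζ : ℂ) : ℂ :=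
  deriv (kernelM D μ n ζ) z

/-- The set `N_D(μ)` of zeros in `D` of the first order kernel on the diagonal. -/
def kernelZeros (D : Set ℂ) (μ : ℂ → ℝ) : Set ℂ :=
  {z | z ∈ D ∧ reducedKernel D μ 1 z z = 0}

end ReducedBergman

/-!
Differentiation identifies `AD^μ(D, ζⁿ)` isometrically with a closed subspace of `L²_μ(D)`, and the
derivative of the kernel function is the Riesz representer of `f' ↦ f⁽ⁿ⁾(ζ)` there. If `D ⊆ D'` and
`μ ≤ μ'` on `D`, then restriction `R : L²_μ'(D') → L²_μ(D)` is a contraction, and the representer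
`k'` of `D'` is the projection of `R* k`, where `k` is that of `D`. Hence
`‖R k' - k‖² ≤ ‖k‖² - ‖k'‖²`, so that convergence of norms forces strong convergence. By
Banach–Steinhaus, strong convergence of derivatives in `L²_μ(D)` gives locally uniform convergence.

For unions the norms decrease eventually, so the representers converge; by Fatou's lemma the norm of
the limit is at most the limit `r` of the norms, while its inner product with the representer `k` of
`D` is `r ≥ ‖k‖²`, so the two agree. For intersections the diagonal hypothesis is convergence of
norms for `n = 1`. As those representers span a dense subspace, the operators `k ↦ R k'` converge
strongly to the identity, and this passes from order `n` to `n + 1`, where the subspace shrinks to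
the orthogonal complement of the representer.
-/

namespace ReducedBergman

section Hilbert

open ContinuousLinearMap InnerProductSpace

variable {𝕜 E F ι : Type*} [RCLike 𝕜] [NormedAddCommGroup E] [InnerProductSpace 𝕜 E]
  [NormedAddCommGroup F] [InnerProductSpace 𝕜 F]

theorem exists_inner_map_eq_of_norm_le {A : Type*} [AddCommGroup A] [Module 𝕜 A] (Φ : A →ₗ[𝕜] E)
    [CompleteSpace (LinearMap.range Φ)] (ℓ : A →ₗ[𝕜] 𝕜) (C : ℝ) (hℓ : ∀ a, ‖ℓ a‖ ≤ C * ‖Φ a‖) :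
    ∃ a₀, ∀ a, inner 𝕜 (Φ a₀) (Φ a) = ℓ a := by
  have hker : LinearMap.ker Φ ≤ LinearMap.ker ℓ := fun a ha => by
    simpa [LinearMap.mem_ker.1 ha] using hℓ a
  let g : LinearMap.range Φ →ₗ[𝕜] 𝕜 :=
    (LinearMap.ker Φ).liftQ ℓ hker ∘ₗ Φ.quotKerEquivRange.symm
  have hg : ∀ a, g ⟨Φ a, LinearMap.mem_range_self Φ a⟩ = ℓ a := fun a => by
    simp [g, LinearMap.quotKerEquivRange_symm_apply_image Φ a (LinearMap.mem_range_self Φ a)]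
  have hgC : ∀ x, ‖g x‖ ≤ C * ‖x‖ := by
    rintro ⟨_, a, rfl⟩
    exact (hg a).symm ▸ hℓ a
  obtain ⟨a₀, ha₀⟩ := ((toDual 𝕜 (LinearMap.range Φ)).symm (g.mkContinuous C hgC)).2
  refine ⟨a₀, fun a => ?_⟩
  rw [ha₀, ← hg a]
  exact toDual_symm_apply (x := (⟨Φ a, LinearMap.mem_range_self Φ a⟩ : LinearMap.range Φ))

theorem le_topologicalClosure_span [CompleteSpace E] {X : Submodule 𝕜 E} (hX : IsClosed (X : Set E))
    {S : Set E} (hSX : S ⊆ X) (hS : ∀ v ∈ X, (∀ s ∈ S, inner 𝕜 s v = 0) → v = 0) :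
    X ≤ (Submodule.span 𝕜 S).topologicalClosure := by
  intro v hv
  set Y := (Submodule.span 𝕜 S).topologicalClosure
  have hYX : Y ≤ X := Submodule.topologicalClosure_minimal _ (Submodule.span_le.2 hSX) hX
  have hSY : S ⊆ Y := Submodule.subset_span.trans (Submodule.le_topologicalClosure _)
  have hproj : v - Y.starProjection v = 0 :=
    hS _ (X.sub_mem hv (hYX (Y.starProjection_apply_mem v))) fun s hs =>
      Submodule.inner_right_of_mem_orthogonal (hSY hs) (Y.sub_starProjection_mem_orthogonal v)
  exact sub_eq_zero.1 hproj ▸ Y.starProjection_apply_mem v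

theorem tendsto_apply_of_mem_topologicalClosure_span {l : Filter ι} {A : ι → E →L[𝕜] F}
    {B : E →L[𝕜] F} {C : ℝ} (hA : ∀ i, ‖A i‖ ≤ C) {S : Set E}
    (hS : ∀ s ∈ S, Tendsto (fun i => A i s) l (𝓝 (B s))) {v : E}
    (hv : v ∈ (Submodule.span 𝕜 S).topologicalClosure) :
    Tendsto (fun i => A i v) l (𝓝 (B v)) := by
  have hspan : ∀ v ∈ Submodule.span 𝕜 S, Tendsto (fun i => A i v) l (𝓝 (B v)) := fun v hv => by
    induction hv using Submodule.span_induction with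
    | mem s hs => exact hS s hs
    | zero => simpa only [map_zero] using tendsto_const_nhds
    | add x y _ _ hx hy => simpa only [map_add] using hx.add hy
    | smul c x _ hx => simpa only [map_smul] using hx.const_smul c
  have hequi : Equicontinuous fun i => (A i : E → F) :=
    (LipschitzWith.uniformEquicontinuous _ C.toNNReal fun i => (A i).lipschitz.weaken
      (norm_toNNReal.symm.trans_le (Real.toNNReal_mono (hA i)))).equicontinuous
  exact (hequi v).tendsto_of_mem_closure B.continuous.continuousAt.continuousWithinAt hspan hv

variable [CompleteSpace E] [CompleteSpace F]

/-- The adjoint of `R` followed by the orthogonal projection onto `K`: it sends the vector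
representing a functional `ℓ` on `E` to the vector representing `ℓ ∘ R` on `K`. -/
noncomputable def projAdjoint (R : F →L[𝕜] E) (K : Submodule 𝕜 F) [K.HasOrthogonalProjection] :
    E →L[𝕜] F :=
  K.starProjection ∘L adjoint R

section

variable (R : F →L[𝕜] E) (K : Submodule 𝕜 F) [K.HasOrthogonalProjection]

theorem projAdjoint_mem (v : E) : projAdjoint R K v ∈ K := K.starProjection_apply_mem _

variable {K}

theorem inner_projAdjoint (v : E) {u : F} (hu : u ∈ K) :
    inner 𝕜 (projAdjoint R K v) u = inner 𝕜 v (R u) := by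
  rw [projAdjoint, comp_apply, Submodule.inner_starProjection_left_eq_right,
    Submodule.starProjection_eq_self_iff.2 hu, adjoint_inner_left]

variable {R}

theorem eq_projAdjoint {v : E} {w : F} (hw : w ∈ K)
    (h : ∀ u ∈ K, inner 𝕜 w u = inner 𝕜 v (R u)) : w = projAdjoint R K v := by
  have hmem : w - projAdjoint R K v ∈ K := K.sub_mem hw (projAdjoint_mem R K v)
  rw [← sub_eq_zero, ← inner_self_eq_zero (𝕜 := 𝕜), inner_sub_left, inner_projAdjoint R v hmem,
    h _ hmem, sub_self]

theorem norm_map_projAdjoint_sub_sq_le (hR : ‖R‖ ≤ 1) (v : E) :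
    ‖R (projAdjoint R K v) - v‖ ^ 2 ≤ ‖v‖ ^ 2 - ‖projAdjoint R K v‖ ^ 2 := by
  have hinner : RCLike.re (inner 𝕜 (R (projAdjoint R K v)) v) = ‖projAdjoint R K v‖ ^ 2 := by
    rw [← inner_re_symm, ← inner_projAdjoint R v (projAdjoint_mem R K v), inner_self_eq_norm_sq]
  have hle : ‖R (projAdjoint R K v)‖ ^ 2 ≤ ‖projAdjoint R K v‖ ^ 2 := by
    gcongr
    exact (R.le_of_opNorm_le hR _).trans_eq (one_mul _)
  rw [norm_sub_sq (𝕜 := 𝕜), hinner]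
  linarith

theorem norm_projAdjoint_le (hR : ‖R‖ ≤ 1) (v : E) : ‖projAdjoint R K v‖ ≤ ‖v‖ := by
  refine (sq_le_sq₀ (norm_nonneg _) (norm_nonneg v)).1 (sub_nonneg.1 ?_)
  exact (sq_nonneg _).trans (norm_map_projAdjoint_sub_sq_le hR v)

theorem projAdjoint_eq_sub_smul {L : Submodule 𝕜 F} [L.HasOrthogonalProjection] {k v : E}
    (hL : ∀ u, u ∈ L ↔ u ∈ K ∧ inner 𝕜 (projAdjoint R K k) u = 0) :
    projAdjoint R L v = projAdjoint R K v -
      (inner 𝕜 k (R (projAdjoint R K v)) / inner 𝕜 k (R (projAdjoint R K k))) •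
        projAdjoint R K k := by
  simp only [← inner_projAdjoint R k (projAdjoint_mem R K _)]
  refine (eq_projAdjoint ((hL _).2 ⟨?_, ?_⟩) fun u hu => ?_).symm
  · exact K.sub_mem (projAdjoint_mem R K v) (K.smul_mem _ (projAdjoint_mem R K k))
  · rw [inner_sub_right, inner_smul_right]
    by_cases hk : projAdjoint R K k = 0
    · simp [hk]
    · rw [div_mul_cancel₀ _ (inner_self_ne_zero.2 hk), sub_self]
  · obtain ⟨huK, hku⟩ := (hL u).1 hu
    rw [inner_sub_left, inner_smul_left, hku, mul_zero, sub_zero, inner_projAdjoint R v huK]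

end

variable {G : ι → Type*} [∀ i, NormedAddCommGroup (G i)] [∀ i, InnerProductSpace 𝕜 (G i)]
  [∀ i, CompleteSpace (G i)] {l : Filter ι} {R : ∀ i, G i →L[𝕜] E} {K L : ∀ i, Submodule 𝕜 (G i)}
  [∀ i, (K i).HasOrthogonalProjection] [∀ i, (L i).HasOrthogonalProjection]

theorem tendsto_map_projAdjoint_of_tendsto_norm_sq (hR : ∀ i, ‖R i‖ ≤ 1) {v : E}
    (hv : Tendsto (fun i => ‖projAdjoint (R i) (K i) v‖ ^ 2) l (𝓝 (‖v‖ ^ 2))) :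
    Tendsto (fun i => R i (projAdjoint (R i) (K i) v)) l (𝓝 v) := by
  have hsq : Tendsto (fun i => ‖R i (projAdjoint (R i) (K i) v) - v‖ ^ 2) l (𝓝 0) :=
    squeeze_zero (fun i => sq_nonneg _) (fun i => norm_map_projAdjoint_sub_sq_le (hR i) v)
      (sub_self (‖v‖ ^ 2) ▸ hv.const_sub (‖v‖ ^ 2))
  rw [tendsto_iff_norm_sub_tendsto_zero]
  simpa using hsq.sqrt

theorem tendsto_map_projAdjoint_of_mem_topologicalClosure_span (hR : ∀ i, ‖R i‖ ≤ 1) {S : Set E}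
    (hS : ∀ s ∈ S, Tendsto (fun i => R i (projAdjoint (R i) (K i) s)) l (𝓝 s)) {v : E}
    (hv : v ∈ (Submodule.span 𝕜 S).topologicalClosure) :
    Tendsto (fun i => R i (projAdjoint (R i) (K i) v)) l (𝓝 v) := by
  refine tendsto_apply_of_mem_topologicalClosure_span (C := 1) (B := .id 𝕜 E)
    (A := fun i => R i ∘L projAdjoint (R i) (K i)) (fun i => ?_) hS hv
  refine opNorm_le_bound _ zero_le_one fun v => ?_
  calc ‖R i (projAdjoint (R i) (K i) v)‖ ≤ 1 * ‖projAdjoint (R i) (K i) v‖ :=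
        (R i).le_of_opNorm_le (hR i) _
    _ ≤ 1 * ‖v‖ := by gcongr; exact norm_projAdjoint_le (hR i) v

theorem tendsto_map_projAdjoint_of_inner_eq_zero {k v : E}
    (hL : ∀ i u, u ∈ L i ↔ u ∈ K i ∧ inner 𝕜 (projAdjoint (R i) (K i) k) u = 0)
    (hk : Tendsto (fun i => R i (projAdjoint (R i) (K i) k)) l (𝓝 k))
    (hv : Tendsto (fun i => R i (projAdjoint (R i) (K i) v)) l (𝓝 v)) (hkv : inner 𝕜 k v = 0) :
    Tendsto (fun i => R i (projAdjoint (R i) (L i) v)) l (𝓝 v) := by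
  have hcoef : Tendsto (fun i => (inner 𝕜 k (R i (projAdjoint (R i) (K i) v)) /
      inner 𝕜 k (R i (projAdjoint (R i) (K i) k))) • R i (projAdjoint (R i) (K i) k)) l (𝓝 0) := by
    rcases eq_or_ne k 0 with rfl | hk0
    · simpa only [map_zero, smul_zero] using tendsto_const_nhds
    · have h := (((tendsto_const_nhds (x := k)).inner (𝕜 := 𝕜) hv).div
        ((tendsto_const_nhds (x := k)).inner (𝕜 := 𝕜) hk)
        (inner_self_ne_zero.2 hk0)).smul hk
      rwa [hkv, zero_div, zero_smul] at h
  simpa only [projAdjoint_eq_sub_smul (hL _), map_sub, map_smul, sub_zero] using hv.sub hcoef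

end Hilbert

section MeasureSpaces

open scoped ENNReal

variable {α : Type*} [MeasurableSpace α] {m m' : Measure α}

open Classical in
/-- The contraction `L²(m') → L²(m)` given by viewing a function as one on the smaller measure
space. It is set to `0` unless `m ≤ m'`, so that it is defined for all members of a family of
measures that are comparable only eventually. -/
noncomputable def l2Restrict (m m' : Measure α) : Lp ℂ 2 m' →L[ℂ] Lp ℂ 2 m :=
  if h : m ≤ m' then
    LinearMap.mkContinuous
      { toFun := fun v => ((Lp.memLp v).mono_measure h).toLp v
        map_add' := fun u v => by
          rw [← MemLp.toLp_add]
          exact MemLp.toLp_congr _ _ ((Lp.coeFn_add u v).filter_mono (ae_mono h))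
        map_smul' := fun c v => by
          rw [RingHom.id_apply, ← MemLp.toLp_const_smul]
          exact MemLp.toLp_congr _ _ ((Lp.coeFn_smul c v).filter_mono (ae_mono h)) }
      1 fun v => by
        rw [one_mul, LinearMap.coe_mk, AddHom.coe_mk, Lp.norm_toLp, Lp.norm_def]
        exact ENNReal.toReal_mono (Lp.eLpNorm_ne_top v) (eLpNorm_mono_measure v h)
  else 0

theorem coeFn_l2Restrict (h : m ≤ m') (v : Lp ℂ 2 m') : l2Restrict m m' v =ᵐ[m] v := by
  rw [l2Restrict, dif_pos h]
  exact ((Lp.memLp v).mono_measure h).coeFn_toLp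

theorem norm_l2Restrict_le_one (m m' : Measure α) : ‖l2Restrict m m'‖ ≤ 1 := by
  rw [l2Restrict]
  split_ifs
  · exact LinearMap.mkContinuous_norm_le _ zero_le_one _
  · simp

theorem norm_l2Restrict_le (v : Lp ℂ 2 m') : ‖l2Restrict m m' v‖ ≤ ‖v‖ :=
  ((l2Restrict m m').le_of_opNorm_le (norm_l2Restrict_le_one m m') v).trans_eq (one_mul _)

theorem l2Restrict_l2Restrict {m'' : Measure α} (h : m ≤ m') (h' : m' ≤ m'') (v : Lp ℂ 2 m'') :
    l2Restrict m m' (l2Restrict m' m'' v) = l2Restrict m m'' v :=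
  Lp.ext <| (coeFn_l2Restrict h _).trans <|
    ((coeFn_l2Restrict h' v).filter_mono (ae_mono h)).trans (coeFn_l2Restrict (h.trans h') v).symm

/-- The classes in `L²(m)` of the square integrable members of a linear space of functions. -/
def l2Classes (S : Submodule ℂ (α → ℂ)) (m : Measure α) : Submodule ℂ (Lp ℂ 2 m) where
  carrier := {v | ∃ f ∈ S, v =ᵐ[m] f}
  add_mem' := by
    rintro u v ⟨f, hf, huf⟩ ⟨g, hg, hvg⟩
    exact ⟨f + g, S.add_mem hf hg, (Lp.coeFn_add u v).trans (huf.add hvg)⟩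
  zero_mem' := ⟨0, S.zero_mem, Lp.coeFn_zero ℂ 2 m⟩
  smul_mem' := by
    rintro c v ⟨f, hf, hvf⟩
    exact ⟨c • f, S.smul_mem c hf, (Lp.coeFn_smul c v).trans (hvf.const_smul c)⟩

theorem exists_mem_l2Classes_inner_eq {S : Submodule ℂ (α → ℂ)}
    (hS : IsClosed (l2Classes S m : Set (Lp ℂ 2 m)))
    (ℓ : S →ₗ[ℂ] ℂ) {C : ℝ} (hℓ : ∀ (f : S) (v : Lp ℂ 2 m), v =ᵐ[m] f → ‖ℓ f‖ ≤ C * ‖v‖) :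
    ∃ k ∈ l2Classes S m, ∀ (f : S) (v : Lp ℂ 2 m), v =ᵐ[m] f → inner ℂ k v = ℓ f := by
  let graph : Submodule ℂ (Lp ℂ 2 m × S) :=
    { carrier := {p | p.1 =ᵐ[m] p.2}
      add_mem' := by
        rintro ⟨u, f⟩ ⟨v, g⟩ (hu : u =ᵐ[m] f) (hv : v =ᵐ[m] g)
        exact (Lp.coeFn_add u v).trans (hu.add hv)
      zero_mem' := Lp.coeFn_zero ℂ 2 m
      smul_mem' := by
        rintro c ⟨u, f⟩ (hu : u =ᵐ[m] f)
        exact (Lp.coeFn_smul c u).trans (hu.const_smul c) }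
  let Φ : graph →ₗ[ℂ] Lp ℂ 2 m := LinearMap.fst ℂ _ _ ∘ₗ graph.subtype
  have hrange : (LinearMap.range Φ : Set (Lp ℂ 2 m)) = l2Classes S m := by
    ext v
    constructor
    · rintro ⟨⟨p, hp⟩, rfl⟩
      exact ⟨p.2, p.2.2, hp⟩
    · rintro ⟨f, hf, hvf⟩
      exact ⟨⟨(v, ⟨f, hf⟩), hvf⟩, rfl⟩
  have : CompleteSpace (LinearMap.range Φ) := (hrange ▸ hS).completeSpace_coe
  obtain ⟨p, hp⟩ := exists_inner_map_eq_of_norm_le Φ (ℓ ∘ₗ LinearMap.snd ℂ _ _ ∘ₗ graph.subtype) C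
    fun (q : graph) => hℓ q.1.2 q.1.1 q.2
  exact ⟨p.1.1, ⟨p.1.2, p.1.2.2, p.2⟩, fun f v hvf => hp ⟨(v, f), hvf⟩⟩

end MeasureSpaces

section Limits

variable {ι X : Type*} {l : Filter ι}

theorem exists_tendsto_of_eventually_eventually_le [l.NeBot] {a : ι → ℝ} {b : ℝ} (hb : ∀ i, b ≤ a i)
    (ha : ∀ᶠ i in l, ∀ᶠ k in l, a k ≤ a i) :
    ∃ c, Tendsto a l (𝓝 c) ∧ ∀ᶠ i in l, c ≤ a i := by
  have hbdd : IsBoundedUnder (· ≤ ·) l a := ha.exists.elim fun i hi => ⟨a i, hi⟩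
  have hbdd' : IsBoundedUnder (· ≥ ·) l a := isBoundedUnder_of ⟨b, hb⟩
  have hle : ∀ᶠ i in l, limsup a l ≤ a i :=
    ha.mono fun i hi => limsup_le_of_le hbdd'.isCoboundedUnder_le hi
  exact ⟨limsup a l, tendsto_of_le_liminf_of_limsup_le
    (le_liminf_of_le hbdd.isCoboundedUnder_ge hle) le_rfl, hle⟩

theorem exists_tendsto_of_eventually_dist_lt [l.NeBot] [PseudoMetricSpace X] [CompleteSpace X]
    {v : ι → X} (h : ∀ ε > 0, ∃ x, ∀ᶠ k in l, dist (v k) x < ε) : ∃ x, Tendsto v l (𝓝 x) := by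
  refine CompleteSpace.complete (Metric.cauchy_iff.2 ⟨inferInstance, fun ε hε => ?_⟩)
  obtain ⟨x, hx⟩ := h (ε / 2) (half_pos hε)
  refine ⟨Metric.ball x (ε / 2), hx, fun y hy z hz => ?_⟩
  linarith [dist_triangle_right y z x, Metric.mem_ball.1 hy, Metric.mem_ball.1 hz]

end Limits

section Weights

variable {D G : Set ℂ} {μ ν : ℂ → ℝ}

theorem weightedArea_absolutelyContinuous (D : Set ℂ) (μ : ℂ → ℝ) :
    weightedArea D μ ≪ volume.restrict D := withDensity_absolutelyContinuous _ _

theorem ae_weightedArea_of_forall_mem (hD : MeasurableSet D) {p : ℂ → Prop} (h : ∀ z ∈ D, p z) :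
    ∀ᵐ z ∂weightedArea D μ, p z :=
  (weightedArea_absolutelyContinuous D μ).ae_le (ae_restrict_of_forall_mem hD h)

theorem weightedArea_mono (hD : MeasurableSet D) (hDG : D ⊆ G) (hμν : ∀ z ∈ D, μ z ≤ ν z) :
    weightedArea D μ ≤ weightedArea G ν := by
  refine Measure.le_iff.2 fun s hs => ?_
  rw [weightedArea, weightedArea, withDensity_apply _ hs, withDensity_apply _ hs]
  calc ∫⁻ z in s, ENNReal.ofReal (μ z) ∂volume.restrict D
      ≤ ∫⁻ z in s, ENNReal.ofReal (ν z) ∂volume.restrict D :=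
        lintegral_mono_ae (ae_restrict_of_ae (ae_restrict_of_forall_mem hD fun z hz =>
          ENNReal.ofReal_le_ofReal (hμν z hz)))
    _ ≤ ∫⁻ z in s, ENNReal.ofReal (ν z) ∂volume.restrict G :=
        lintegral_mono' (Measure.restrict_mono_measure (Measure.restrict_mono_set _ hDG) _) le_rfl

theorem memLp_two_weightedArea_iff (hD : MeasurableSet D) (hμ : AEMeasurable μ (volume.restrict D))
    (hpos : ∀ z ∈ D, 0 ≤ μ z) {f : ℂ → ℂ} (hf : AEStronglyMeasurable f (volume.restrict D)) :
    MemLp f 2 (weightedArea D μ) ↔ IntegrableOn (fun z => ‖f z‖ ^ 2 * μ z) D := by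
  rw [memLp_two_iff_integrable_sq_norm (hf.mono_ac (weightedArea_absolutelyContinuous D μ))]
  refine (integrable_withDensity_iff_integrable_smul₀ hμ.real_toNNReal).trans
    (integrable_congr (ae_restrict_of_forall_mem hD fun z hz => ?_))
  simp only [NNReal.smul_def, Real.coe_toNNReal _ (hpos z hz), smul_eq_mul, mul_comm]

theorem inner_eq_setIntegral (hD : MeasurableSet D) (hμ : AEMeasurable μ (volume.restrict D))
    (hpos : ∀ z ∈ D, 0 ≤ μ z) {u v : Lp ℂ 2 (weightedArea D μ)} {f g : ℂ → ℂ}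
    (hu : u =ᵐ[weightedArea D μ] f) (hv : v =ᵐ[weightedArea D μ] g) :
    inner ℂ u v = ∫ z in D, g z * starRingEnd ℂ (f z) * (μ z : ℂ) := by
  have hcongr : (fun z => inner ℂ (u z) (v z))
      =ᵐ[weightedArea D μ] fun z => g z * starRingEnd ℂ (f z) := by
    filter_upwards [hu, hv] with z hu hv
    rw [RCLike.inner_apply, hu, hv]
  rw [L2.inner_def, integral_congr_ae hcongr]
  refine (integral_withDensity_eq_integral_smul₀ hμ.real_toNNReal _).trans
    (setIntegral_congr_fun hD fun z hz => ?_)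
  simp only [NNReal.smul_def, Real.coe_toNNReal _ (hpos z hz), Complex.real_smul, mul_comm]

theorem norm_sq_eq_setIntegral (hD : MeasurableSet D) (hμ : AEMeasurable μ (volume.restrict D))
    (hpos : ∀ z ∈ D, 0 ≤ μ z) {v : Lp ℂ 2 (weightedArea D μ)} {f : ℂ → ℂ}
    (hv : v =ᵐ[weightedArea D μ] f) : ‖v‖ ^ 2 = ∫ z in D, ‖f z‖ ^ 2 * μ z := by
  have hinner := inner_eq_setIntegral hD hμ hpos hv hv
  have hcongr : ∀ z, f z * starRingEnd ℂ (f z) * (μ z : ℂ) = ((‖f z‖ ^ 2 * μ z : ℝ) : ℂ) :=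
    fun z => by rw [Complex.mul_conj']; push_cast; rfl
  simp only [inner_self_eq_norm_sq_to_K, hcongr, integral_complex_ofReal] at hinner
  exact Complex.ofReal_injective (by simpa using hinner)

open scoped ENNReal

variable {ι : Type*} {l : Filter ι} [l.NeBot] [l.IsCountablyGenerated] {Ω : ι → Set ℂ}
  {w : ι → ℂ → ℝ}

theorem lintegral_weightedArea_le_of_tendsto (hΩ : ∀ i, MeasurableSet (Ω i))
    (hw : ∀ i, AEMeasurable (w i) (volume.restrict (Ω i)))
    (hμ : AEMeasurable μ (volume.restrict D)) (hD : MeasurableSet D) (hΩD : ∀ i, Ω i ⊆ D)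
    (hmem : ∀ z ∈ D, ∀ᶠ i in l, z ∈ Ω i)
    (hlim : ∀ᵐ z ∂volume.restrict D, Tendsto (fun i => w i z) l (𝓝 (μ z))) {g : ℂ → ℝ≥0∞}
    (hg : AEMeasurable g (volume.restrict D)) {C : ℝ≥0∞}
    (hC : ∀ᶠ i in l, ∫⁻ z, g z ∂weightedArea (Ω i) (w i) ≤ C) :
    ∫⁻ z, g z ∂weightedArea D μ ≤ C := by
  obtain ⟨s, hs⟩ := l.exists_seq_tendsto
  have hgΩ : ∀ i, AEMeasurable g (volume.restrict (Ω i)) := fun i =>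
    hg.mono_measure (Measure.restrict_mono_set _ (hΩD i))
  let h (i : ι) : ℂ → ℝ≥0∞ := (Ω i).indicator fun z => ENNReal.ofReal (w i z) * g z
  have hh : ∀ i, AEMeasurable (h i) (volume.restrict D) := fun i =>
    ((aemeasurable_indicator_iff (hΩ i)).2 ((hw i).ennreal_ofReal.mul (hgΩ i))).restrict
  have hhC : ∀ᶠ i in l, ∫⁻ z in D, h i z ≤ C := hC.mono fun i hi => by
    refine (setLIntegral_le_lintegral D _).trans (le_trans (le_of_eq ?_) hi)
    rw [lintegral_indicator (hΩ i), weightedArea, lintegral_withDensity_eq_lintegral_mul₀'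
      (hw i).ennreal_ofReal ((hgΩ i).mono_ac (withDensity_absolutelyContinuous _ _))]
    rfl
  have hlim' : ∀ᵐ z ∂volume.restrict D,
      ENNReal.ofReal (μ z) * g z ≤ liminf (fun n => h (s n) z) atTop := by
    filter_upwards [hlim, ae_restrict_mem hD] with z hz hzD
    rcases eq_or_ne (ENNReal.ofReal (μ z)) 0 with hz0 | hz0
    · simp [hz0]
    · have hlimz : Tendsto (fun n => h (s n) z) atTop (𝓝 (ENNReal.ofReal (μ z) * g z)) := by
        refine (ENNReal.Tendsto.mul_const (ENNReal.tendsto_ofReal (hz.comp hs))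
          (Or.inl hz0)).congr' ?_
        filter_upwards [hs.eventually (hmem z hzD)] with n hn
        simp only [h, Set.indicator_of_mem hn, Function.comp_apply]
      exact hlimz.liminf_eq.ge
  calc ∫⁻ z, g z ∂weightedArea D μ = ∫⁻ z in D, ENNReal.ofReal (μ z) * g z :=
        lintegral_withDensity_eq_lintegral_mul₀' hμ.ennreal_ofReal
          (hg.mono_ac (withDensity_absolutelyContinuous _ _))
    _ ≤ ∫⁻ z in D, liminf (fun n => h (s n) z) atTop := lintegral_mono_ae hlim'
    _ ≤ liminf (fun n => ∫⁻ z in D, h (s n) z) atTop := lintegral_liminf_le' fun n => hh (s n)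
    _ ≤ C := liminf_le_of_frequently_le' (hs.eventually hhC).frequently

theorem eLpNorm_two_weightedArea_le_of_tendsto (hΩ : ∀ i, MeasurableSet (Ω i))
    (hw : ∀ i, AEMeasurable (w i) (volume.restrict (Ω i)))
    (hμ : AEMeasurable μ (volume.restrict D)) (hD : MeasurableSet D) (hΩD : ∀ i, Ω i ⊆ D)
    (hmem : ∀ z ∈ D, ∀ᶠ i in l, z ∈ Ω i)
    (hlim : ∀ᵐ z ∂volume.restrict D, Tendsto (fun i => w i z) l (𝓝 (μ z))) {f : ℂ → ℂ}
    (hf : AEStronglyMeasurable f (volume.restrict D)) {C : ℝ≥0∞}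
    (hC : ∀ᶠ i in l, eLpNorm f 2 (weightedArea (Ω i) (w i)) ≤ C) :
    eLpNorm f 2 (weightedArea D μ) ≤ C := by
  have hsq : ∀ m : Measure ℂ, ∫⁻ z, ‖f z‖ₑ ^ (2 : ℝ) ∂m = eLpNorm f 2 m ^ (2 : ℝ) := fun m =>
    (eLpNorm_nnreal_pow_eq_lintegral (p := 2) two_ne_zero).symm
  rw [← ENNReal.rpow_le_rpow_iff (z := 2) two_pos, ← hsq]
  refine lintegral_weightedArea_le_of_tendsto hΩ hw hμ hD hΩD hmem hlim (hf.enorm.pow_const _)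
    (hC.mono fun i hi => ?_)
  rw [hsq]
  exact ENNReal.rpow_le_rpow hi two_pos.le

end Weights

section LocallyUniformLimits

variable {ι : Type*} {l : Filter ι} {F : ι → ℂ → ℂ} {f : ℂ → ℂ} {D : Set ℂ} {ζ : ℂ}

theorem tendstoUniformlyOn_of_tendstoUniformlyOn_deriv {P : ℂ → ℂ} {B : Set ℂ} (hB : Convex ℝ B)
    (hBb : Bornology.IsBounded B) (hF : ∀ᶠ k in l, ∀ z ∈ B, DifferentiableAt ℂ (F k) z)
    (hP : ∀ z ∈ B, HasDerivAt P (f z) z)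
    (hlim : TendstoUniformlyOn (fun k => deriv (F k)) f l B) {p : ℂ} (hp : p ∈ B)
    (hFp : Tendsto (fun k => F k p) l (𝓝 (P p))) : TendstoUniformlyOn F P l B := by
  rw [Metric.tendstoUniformlyOn_iff] at hlim ⊢
  intro ε hε
  obtain ⟨R, hR0, hR⟩ := hBb.exists_pos_norm_le
  have hdiam : ∀ z ∈ B, ‖z - p‖ ≤ 2 * R := fun z hz => by
    linarith [norm_sub_le z p, hR z hz, hR p hp]
  filter_upwards [hF, hlim (ε / (4 * R)) (by positivity),
    Metric.tendsto_nhds.1 hFp (ε / 2) (half_pos hε)] with k hFk hk hkp z hz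
  have hmean : ‖(P z - F k z) - (P p - F k p)‖ ≤ ε / (4 * R) * ‖z - p‖ := by
    refine hB.norm_image_sub_le_of_norm_hasDerivWithin_le (f := fun z => P z - F k z)
      (fun y hy => ((hP y hy).sub (hFk y hy).hasDerivAt).hasDerivWithinAt) (fun y hy => ?_) hp hz
    rw [← dist_eq_norm]
    exact (hk y hy).le
  calc dist (P z) (F k z) = ‖((P z - F k z) - (P p - F k p)) + (P p - F k p)‖ := by
        rw [sub_add_cancel, dist_eq_norm]
    _ ≤ ε / (4 * R) * (2 * R) + dist (F k p) (P p) := by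
        rw [dist_comm, dist_eq_norm]
        exact (norm_add_le _ _).trans (by gcongr; exact hmean.trans (by gcongr; exact hdiam z hz))
    _ < ε / 2 + ε / 2 := by
        have : ε / (4 * R) * (2 * R) = ε / 2 := by field_simp; ring
        linarith
    _ = ε := add_halves ε

variable [l.NeBot] (hD : IsOpen D) (hF : ∀ᶠ k in l, DifferentiableOn ℂ (F k) D)
  (hlim : TendstoLocallyUniformlyOn (fun k => deriv (F k)) f l D)
include hD hF hlim

theorem exists_mem_nhds_tendstoUniformlyOn_of_deriv {x : ℂ} (hx : x ∈ D) :
    ∃ B ∈ 𝓝 x, B ⊆ D ∧ ∀ p ∈ B, ∀ c, Tendsto (fun k => F k p) l (𝓝 c) →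
      ∃ P, P p = c ∧ (∀ z ∈ B, HasDerivAt P (f z) z) ∧ TendstoUniformlyOn F P l B := by
  obtain ⟨r, hr, hrD⟩ := Metric.nhds_basis_closedBall.mem_iff.1 (hD.mem_nhds hx)
  have hBD : Metric.ball x r ⊆ D := Metric.ball_subset_closedBall.trans hrD
  have hfB : DifferentiableOn ℂ f (Metric.ball x r) :=
    (hlim.differentiableOn (hF.mono fun k hk => hk.deriv hD) hD).mono hBD
  refine ⟨Metric.ball x r, Metric.ball_mem_nhds x hr, hBD, fun p hp c hc => ?_⟩
  obtain ⟨P, rfl, hP⟩ := hfB.isExactOn_ball.with_val_at p c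
  refine ⟨P, rfl, hP, tendstoUniformlyOn_of_tendstoUniformlyOn_deriv (convex_ball x r)
    Metric.isBounded_ball (hF.mono fun k hk z hz => hk.differentiableAt (hD.mem_nhds (hBD hz)))
    hP ?_ hp hc⟩
  exact ((tendstoLocallyUniformlyOn_iff_forall_isCompact hD).1 hlim _ hrD
    (isCompact_closedBall x r)).mono Metric.ball_subset_closedBall

theorem exists_tendstoLocallyUniformlyOn_of_deriv (hD' : IsPreconnected D) (hζ : ζ ∈ D) {c : ℂ}
    (hc : Tendsto (fun k => F k ζ) l (𝓝 c)) :
    ∃ G, G ζ = c ∧ (∀ z ∈ D, HasDerivAt G (f z) z) ∧ TendstoLocallyUniformlyOn F G l D := by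
  have hlocal := fun x (hx : x ∈ D) => exists_mem_nhds_tendstoUniformlyOn_of_deriv hD hF hlim hx
  have hconv : ∀ x ∈ D, ∃ c, Tendsto (fun k => F k x) l (𝓝 c) := fun x hx => by
    refine hD'.induction₂' (fun x y => (∃ c, Tendsto (fun k => F k x) l (𝓝 c)) →
      ∃ c, Tendsto (fun k => F k y) l (𝓝 c)) (fun x hx => ?_) (fun _ _ _ _ _ _ h h' => h' ∘ h)
      hζ hx ⟨c, hc⟩
    obtain ⟨B, hB, -, hprim⟩ := hlocal x hx
    have hspread : ∀ p ∈ B, ∀ q ∈ B, (∃ c, Tendsto (fun k => F k p) l (𝓝 c)) →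
        ∃ c, Tendsto (fun k => F k q) l (𝓝 c) := fun p hp q hq ⟨c, hc⟩ => by
      obtain ⟨P, -, -, hP⟩ := hprim p hp c hc
      exact ⟨P q, hP.tendsto_at hq⟩
    filter_upwards [mem_nhdsWithin_of_mem_nhds hB] with y hy
    exact ⟨hspread x (mem_of_mem_nhds hB) y hy, hspread y hy x (mem_of_mem_nhds hB)⟩
  choose! G hG using hconv
  have hGlocal : ∀ x ∈ D, ∃ B ∈ 𝓝 x, (∀ z ∈ B, HasDerivAt G (f z) z) ∧
      TendstoUniformlyOn F G l B := fun x hx => by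
    obtain ⟨B, hB, hBD, hprim⟩ := hlocal x hx
    obtain ⟨P, -, hP, hFP⟩ := hprim x (mem_of_mem_nhds hB) _ (hG x hx)
    have hPG : ∀ z ∈ B, P z = G z := fun z hz =>
      tendsto_nhds_unique (hFP.tendsto_at hz) (hG z (hBD hz))
    exact ⟨interior B, interior_mem_nhds.2 hB, fun z hz =>
      (hP z (interior_subset hz)).congr_of_eventuallyEq (by
        filter_upwards [isOpen_interior.mem_nhds hz] with y hy
        exact (hPG y (interior_subset hy)).symm),
      (hFP.congr_right hPG).mono interior_subset⟩
  refine ⟨G, tendsto_nhds_unique (hG ζ hζ) hc, fun z hz => ?_,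
    tendstoLocallyUniformlyOn_of_forall_exists_nhds fun x hx => ?_⟩
  · obtain ⟨B, hB, hGB, -⟩ := hGlocal z hz
    exact hGB z (mem_of_mem_nhds hB)
  · obtain ⟨B, hB, -, hFB⟩ := hGlocal x hx
    exact ⟨B, mem_nhdsWithin_of_mem_nhds hB, hFB⟩

theorem tendstoLocallyUniformlyOn_of_deriv (hD' : IsPreconnected D) (hζ : ζ ∈ D) {P : ℂ → ℂ}
    (hP : ∀ z ∈ D, HasDerivAt P (f z) z) (hFP : Tendsto (fun k => F k ζ) l (𝓝 (P ζ))) :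
    TendstoLocallyUniformlyOn F P l D := by
  obtain ⟨G, hGζ, hG, hFG⟩ := exists_tendstoLocallyUniformlyOn_of_deriv hD hF hlim hD' hζ hFP
  refine hFG.congr_right (hD.eqOn_of_deriv_eq hD'
    (fun z hz => (hG z hz).differentiableAt.differentiableWithinAt)
    (fun z hz => (hP z hz).differentiableAt.differentiableWithinAt)
    (fun z hz => (hG z hz).deriv.trans (hP z hz).deriv.symm) hζ hGζ)

end LocallyUniformLimits

section BergmanSpace

variable {D : Set ℂ} {μ : ℂ → ℝ}

/-- The functions holomorphic on `D`, as a linear space of functions on `ℂ`. -/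
def holomorphicOn (D : Set ℂ) : Submodule ℂ (ℂ → ℂ) where
  carrier := {f | DifferentiableOn ℂ f D}
  add_mem' hf hg := DifferentiableOn.add hf hg
  zero_mem' := differentiableOn_const 0
  smul_mem' c _ hf := DifferentiableOn.const_smul hf c

theorem aestronglyMeasurable_of_differentiableOn (hD : IsOpen D) {f : ℂ → ℂ}
    (hf : DifferentiableOn ℂ f D) : AEStronglyMeasurable f (volume.restrict D) :=
  hf.continuousOn.aestronglyMeasurable hD.measurableSet

namespace AdmissibleWeight

variable (hμ : AdmissibleWeight D μ) (hD : IsOpen D)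
include hμ hD

theorem mem_bergmanSpace_iff {f : ℂ → ℂ} :
    f ∈ bergmanSpace D μ ↔ DifferentiableOn ℂ f D ∧ MemLp f 2 (weightedArea D μ) :=
  and_congr_right fun hf => (memLp_two_weightedArea_iff hD.measurableSet hμ.measurable
    (fun z hz => (hμ.pos z hz).le) (aestronglyMeasurable_of_differentiableOn hD hf)).symm

theorem isClosed_l2Classes_holomorphicOn :
    IsClosed (l2Classes (holomorphicOn D) (weightedArea D μ) :
      Set (Lp ℂ 2 (weightedArea D μ))) := by
  refine (congrArg IsClosed ?_).mp hμ.isClosed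
  ext v
  exact exists_congr fun f => and_congr_left fun hvf => (hμ.mem_bergmanSpace_iff hD).trans
    (and_iff_left ((memLp_congr_ae hvf).1 (Lp.memLp v)))

theorem exists_inner_eq_apply {z : ℂ} (hz : z ∈ D) :
    ∃ k : Lp ℂ 2 (weightedArea D μ), ∀ f, DifferentiableOn ℂ f D →
      ∀ v : Lp ℂ 2 (weightedArea D μ), v =ᵐ[weightedArea D μ] f → inner ℂ k v = f z := by
  obtain ⟨C, hC⟩ := hμ.evaluation z hz
  obtain ⟨k, -, hkv⟩ := exists_mem_l2Classes_inner_eq (hμ.isClosed_l2Classes_holomorphicOn hD)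
    (LinearMap.proj z ∘ₗ (holomorphicOn D).subtype) (C := C) fun f v hvf => by
      have hf := hC f ((hμ.mem_bergmanSpace_iff hD).2 ⟨f.2, (memLp_congr_ae hvf).1 (Lp.memLp v)⟩)
      rwa [← norm_sq_eq_setIntegral hD.measurableSet hμ.measurable (fun z hz => (hμ.pos z hz).le)
        hvf, Real.sqrt_sq (norm_nonneg v)] at hf
  exact ⟨k, fun f hf v hvf => hkv ⟨f, hf⟩ v hvf⟩

theorem exists_forall_norm_apply_le {K : Set ℂ} (hK : IsCompact K) (hKD : K ⊆ D) :
    ∃ C, ∀ f, DifferentiableOn ℂ f D → ∀ v : Lp ℂ 2 (weightedArea D μ),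
      v =ᵐ[weightedArea D μ] f → ∀ z ∈ K, ‖f z‖ ≤ C * ‖v‖ := by
  set X := l2Classes (holomorphicOn D) (weightedArea D μ)
  have : CompleteSpace X := (hμ.isClosed_l2Classes_holomorphicOn hD).completeSpace_coe
  choose! k hkf using fun z (hz : z ∈ D) => hμ.exists_inner_eq_apply hD hz
  obtain ⟨C, hC⟩ := banach_steinhaus
    (g := fun z : K => innerSL ℂ (k z) ∘L X.subtypeL) fun v => by
      obtain ⟨f, hf, hvf⟩ := v.2
      obtain ⟨B, hB⟩ := hK.exists_bound_of_continuousOn (hf.continuousOn.mono hKD)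
      exact ⟨B, fun z => (congrArg norm (hkf z (hKD z.2) f hf v hvf)).trans_le (hB z z.2)⟩
  refine ⟨C, fun f hf v hvf z hz => ?_⟩
  rw [← hkf z (hKD hz) f hf v hvf]
  exact ContinuousLinearMap.le_of_opNorm_le _ (hC ⟨z, hz⟩) (⟨v, f, hf, hvf⟩ : X)

theorem eqOn_of_ae_eq {f g : ℂ → ℂ} (hf : DifferentiableOn ℂ f D) (hg : DifferentiableOn ℂ g D)
    (hfg : f =ᵐ[weightedArea D μ] g) : Set.EqOn f g D := fun z hz => by
  obtain ⟨C, hC⟩ := hμ.exists_forall_norm_apply_le hD isCompact_singleton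
    (Set.singleton_subset_iff.2 hz)
  have hzero : (0 : Lp ℂ 2 (weightedArea D μ)) =ᵐ[weightedArea D μ] f - g := by
    filter_upwards [hfg, Lp.coeFn_zero ℂ 2 (weightedArea D μ)] with x hx hx0
    rw [hx0, Pi.sub_apply, hx, sub_self, Pi.zero_apply]
  simpa [sub_eq_zero] using hC (f - g) (hf.sub hg) 0 hzero z rfl

variable {ι : Type*} {l : Filter ι} {v : ι → Lp ℂ 2 (weightedArea D μ)}
  {v₀ : Lp ℂ 2 (weightedArea D μ)} {F : ι → ℂ → ℂ} {f : ℂ → ℂ}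

theorem tendstoLocallyUniformlyOn (hF : ∀ᶠ k in l, DifferentiableOn ℂ (F k) D)
    (hvF : ∀ᶠ k in l, v k =ᵐ[weightedArea D μ] F k) (hf : DifferentiableOn ℂ f D)
    (hvf : v₀ =ᵐ[weightedArea D μ] f) (hv : Tendsto v l (𝓝 v₀)) :
    TendstoLocallyUniformlyOn F f l D := by
  refine (tendstoLocallyUniformlyOn_iff_forall_isCompact hD).2 fun K hKD hK => ?_
  obtain ⟨C, hC⟩ := hμ.exists_forall_norm_apply_le hD hK hKD
  refine Metric.tendstoUniformlyOn_iff.2 fun ε hε => ?_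
  have hlim : Tendsto (fun k => C * ‖v₀ - v k‖) l (𝓝 0) := by
    simpa using (hv.const_sub v₀).norm.const_mul C
  filter_upwards [hF, hvF, hlim.eventually_lt_const hε] with k hFk hvFk hk z hz
  rw [dist_eq_norm]
  have hsub : ⇑(v₀ - v k) =ᵐ[weightedArea D μ] f - F k :=
    (Lp.coeFn_sub _ _).trans (hvf.sub hvFk)
  exact (hC (f - F k) (hf.sub hFk) (v₀ - v k) hsub z hz).trans_lt hk

end AdmissibleWeight

variable (hμ : AdmissibleWeight D μ) (hD : IsPlanarDomain D) {ι : Type*} {l : Filter ι} [l.NeBot]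
  {v : ι → Lp ℂ 2 (weightedArea D μ)} {v₀ : Lp ℂ 2 (weightedArea D μ)} {F : ι → ℂ → ℂ} {ζ : ℂ}
  (hζ : ζ ∈ D) (hF : ∀ᶠ k in l, DifferentiableOn ℂ (F k) D)
  (hvF : ∀ᶠ k in l, v k =ᵐ[weightedArea D μ] deriv (F k)) (hv : Tendsto v l (𝓝 v₀))
include hμ hD hζ hF hvF hv

namespace AdmissibleWeight

theorem tendstoLocallyUniformlyOn_of_deriv {P : ℂ → ℂ} (hP : DifferentiableOn ℂ P D)
    (hvP : v₀ =ᵐ[weightedArea D μ] deriv P) (hFP : Tendsto (fun k => F k ζ) l (𝓝 (P ζ))) :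
    TendstoLocallyUniformlyOn F P l D :=
  ReducedBergman.tendstoLocallyUniformlyOn_of_deriv hD.1 hF
    (hμ.tendstoLocallyUniformlyOn hD.1 (hF.mono fun _ hk => hk.deriv hD.1) hvF (hP.deriv hD.1) hvP
      hv) hD.2.isPreconnected hζ (fun _ hz => hP.hasDerivAt (hD.1.mem_nhds hz)) hFP

theorem exists_tendstoLocallyUniformlyOn_of_deriv {c : ℂ}
    (hc : Tendsto (fun k => F k ζ) l (𝓝 c)) :
    ∃ P, P ζ = c ∧ DifferentiableOn ℂ P D ∧ v₀ =ᵐ[weightedArea D μ] deriv P ∧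
      TendstoLocallyUniformlyOn F P l D := by
  obtain ⟨f, hf, hvf⟩ := (hμ.isClosed_l2Classes_holomorphicOn hD.1).mem_of_tendsto hv
    ((hF.and hvF).mono fun k hk => ⟨deriv (F k), hk.1.deriv hD.1, hk.2⟩)
  obtain ⟨P, hPζ, hP, hFP⟩ := ReducedBergman.exists_tendstoLocallyUniformlyOn_of_deriv hD.1 hF
    (hμ.tendstoLocallyUniformlyOn hD.1 (hF.mono fun _ hk => hk.deriv hD.1) hvF hf hvf hv)
    hD.2.isPreconnected hζ hc
  exact ⟨P, hPζ, fun z hz => (hP z hz).differentiableAt.differentiableWithinAt,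
    hvf.trans (ae_weightedArea_of_forall_mem hD.1.measurableSet fun z hz => (hP z hz).deriv.symm),
    hFP⟩

end AdmissibleWeight

end BergmanSpace

section KernelClasses

/-- The functions with a primitive on `D` that vanish to order at least `m` at `ζ`. For a planar
domain `D ∋ ζ` and `n = m + 1`, these are on `D` the derivatives of the holomorphic functions on `D`
that vanish at `ζ` together with their derivatives of order less than `n`. -/
noncomputable def exactVanishing (D : Set ℂ) (m : ℕ) (ζ : ℂ) : Submodule ℂ (ℂ → ℂ) where
  carrier := {f | Complex.IsExactOn f D ∧ (m : ℕ∞) ≤ analyticOrderAt f ζ}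
  add_mem' := by
    rintro f g ⟨⟨F, hF⟩, hfm⟩ ⟨⟨G, hG⟩, hgm⟩
    exact ⟨⟨F + G, fun z hz => (hF z hz).add (hG z hz)⟩,
      (le_min hfm hgm).trans le_analyticOrderAt_add⟩
  zero_mem' := ⟨⟨0, fun z _ => hasDerivAt_const z 0⟩,
    le_top.trans_eq (analyticOrderAt_eq_top.2 (Eventually.of_forall fun _ => rfl)).symm⟩
  smul_mem' := by
    rintro c f ⟨⟨F, hF⟩, hfm⟩
    refine ⟨⟨c • F, fun z hz => (hF z hz).const_smul c⟩, ?_⟩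
    by_cases hf : AnalyticAt ℂ f ζ
    · exact hfm.trans ((analyticOrderAt_smul (f := fun _ => c) analyticAt_const hf).symm ▸
        le_add_self)
    · rw [analyticOrderAt_of_not_analyticAt hf] at hfm
      exact hfm.trans bot_le

/-- The classes in `L²_μ(D)` of the derivatives of the members of `AD^μ(D, ζᵐ⁺¹)`. Differentiation
identifies that space isometrically with this subspace. -/
noncomputable abbrev derivClasses (D : Set ℂ) (μ : ℂ → ℝ) (m : ℕ) (ζ : ℂ) :
    Submodule ℂ (Lp ℂ 2 (weightedArea D μ)) :=
  l2Classes (exactVanishing D m ζ) (weightedArea D μ)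

/-- `k` is the class of the derivative of the kernel function `M_{D,μ,m+1}(·, ζ)`: it represents the
functional `f' ↦ (f')⁽ᵐ⁾(ζ)` on the derivatives of the members of `AD^μ(D, ζᵐ⁺¹)`. -/
structure IsKernelClass (D : Set ℂ) (μ : ℂ → ℝ) (m : ℕ) (ζ : ℂ)
    (k : Lp ℂ 2 (weightedArea D μ)) : Prop where
  mem : k ∈ derivClasses D μ m ζ
  inner_eq : ∀ g ∈ exactVanishing D m ζ, ∀ u : Lp ℂ 2 (weightedArea D μ),
    u =ᵐ[weightedArea D μ] g → inner ℂ k u = iteratedDeriv m g ζ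

variable {D : Set ℂ} {μ : ℂ → ℝ} {m : ℕ} {ζ : ℂ}

theorem differentiableOn_of_mem_exactVanishing (hD : IsOpen D) {f : ℂ → ℂ}
    (hf : f ∈ exactVanishing D m ζ) : DifferentiableOn ℂ f D :=
  hf.1.differentiableOn hD

theorem mem_exactVanishing_iff (hD : IsOpen D) (hζ : ζ ∈ D) {f : ℂ → ℂ} :
    f ∈ exactVanishing D m ζ ↔ Complex.IsExactOn f D ∧ ∀ k < m, iteratedDeriv k f ζ = 0 :=
  and_congr_right fun hf => natCast_le_analyticOrderAt_iff_iteratedDeriv_eq_zero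
    ((hf.differentiableOn hD).analyticAt (hD.mem_nhds hζ))

theorem exactVanishing_mono {D' : Set ℂ} (hD : D ⊆ D') :
    exactVanishing D' m ζ ≤ exactVanishing D m ζ :=
  fun _ hf => ⟨hf.1.imp fun _ hF z hz => hF z (hD hz), hf.2⟩

theorem mem_exactVanishing_zero_iff {f : ℂ → ℂ} :
    f ∈ exactVanishing D 0 ζ ↔ Complex.IsExactOn f D :=
  and_iff_left bot_le

theorem deriv_mem_exactVanishing_zero (hD : IsOpen D) {F : ℂ → ℂ} (hF : DifferentiableOn ℂ F D) :
    deriv F ∈ exactVanishing D 0 ζ :=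
  mem_exactVanishing_zero_iff.2 ⟨F, fun _ hz => hF.hasDerivAt (hD.mem_nhds hz)⟩

theorem exists_deriv_eqOn_of_mem_exactVanishing {f : ℂ → ℂ}
    (hf : f ∈ exactVanishing D m ζ) :
    ∃ F, F ζ = 0 ∧ DifferentiableOn ℂ F D ∧ Set.EqOn (deriv F) f D := by
  obtain ⟨F, hFζ, hF⟩ := hf.1.with_val_at ζ 0
  exact ⟨F, hFζ, fun z hz => (hF z hz).differentiableAt.differentiableWithinAt,
    fun z hz => (hF z hz).deriv⟩

variable (hμ : AdmissibleWeight D μ)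
include hμ

theorem AdmissibleWeight.mem_adSpace_succ_iff (hD : IsOpen D) (hζ : ζ ∈ D) {f : ℂ → ℂ} :
    f ∈ adSpace D μ (m + 1) ζ ↔ DifferentiableOn ℂ f D ∧ f ζ = 0 ∧
      deriv f ∈ exactVanishing D m ζ ∧ MemLp (deriv f) 2 (weightedArea D μ) := by
  refine and_congr_right fun hf => ?_
  have hexact : Complex.IsExactOn (deriv f) D :=
    ⟨f, fun z hz => hf.hasDerivAt (hD.mem_nhds hz)⟩
  have hint : IntegrableOn (fun z => ‖deriv f z‖ ^ 2 * μ z) D ↔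
      MemLp (deriv f) 2 (weightedArea D μ) :=
    (memLp_two_weightedArea_iff hD.measurableSet hμ.measurable (fun z hz => (hμ.pos z hz).le)
      (aestronglyMeasurable_of_differentiableOn hD (hf.deriv hD))).symm
  rw [mem_exactVanishing_iff hD hζ, and_iff_right hexact, hint, ← and_assoc]
  refine and_congr_left fun _ => ⟨fun h => ⟨?_, fun k hk => ?_⟩, fun ⟨h0, h⟩ k hk => ?_⟩
  · simpa using h 0 m.succ_pos
  · rw [← iteratedDeriv_succ']
    exact h (k + 1) (Nat.succ_lt_succ hk)
  · cases k with
    | zero => simpa using h0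
    | succ k => rw [iteratedDeriv_succ', h k (Nat.lt_of_succ_lt_succ hk)]

theorem AdmissibleWeight.exists_forall_norm_iteratedDeriv_le (hD : IsOpen D) (hζ : ζ ∈ D) (k : ℕ) :
    ∃ C, ∀ f, DifferentiableOn ℂ f D → ∀ v : Lp ℂ 2 (weightedArea D μ),
      v =ᵐ[weightedArea D μ] f → ‖iteratedDeriv k f ζ‖ ≤ C * ‖v‖ := by
  obtain ⟨r, hr, hrD⟩ := Metric.nhds_basis_closedBall.mem_iff.1 (hD.mem_nhds hζ)
  obtain ⟨C, hC⟩ := hμ.exists_forall_norm_apply_le hD (isCompact_closedBall ζ r) hrD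
  refine ⟨k.factorial * C / r ^ k, fun f hf v hvf => ?_⟩
  calc ‖iteratedDeriv k f ζ‖ ≤ k.factorial * (C * ‖v‖) / r ^ k :=
        Complex.norm_iteratedDeriv_le_of_forall_mem_sphere_norm_le k hr
          (hf.diffContOnCl_ball hrD) fun z hz =>
            hC f hf v hvf z (Metric.sphere_subset_closedBall hz)
    _ = k.factorial * C / r ^ k * ‖v‖ := by ring

variable (hD : IsOpen D) (hζ : ζ ∈ D)
include hD hζ

theorem AdmissibleWeight.exists_isKernelClass_of_isClosed
    (hX : IsClosed (derivClasses D μ m ζ : Set (Lp ℂ 2 (weightedArea D μ)))) :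
    ∃ k, IsKernelClass D μ m ζ k := by
  obtain ⟨C, hC⟩ := hμ.exists_forall_norm_iteratedDeriv_le hD hζ m
  have hcont : ∀ f : exactVanishing D m ζ, ContDiffAt ℂ m (f : ℂ → ℂ) ζ := fun f =>
    ((differentiableOn_of_mem_exactVanishing hD f.2).analyticAt (hD.mem_nhds hζ)).contDiffAt
  obtain ⟨k, hk, hkf⟩ := exists_mem_l2Classes_inner_eq hX (C := C)
    { toFun := fun f => iteratedDeriv m (f : ℂ → ℂ) ζ
      map_add' := fun f g => iteratedDeriv_add (hcont f) (hcont g)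
      map_smul' := fun c f => iteratedDeriv_const_smul (hcont f) c }
    fun f v hvf => hC f (differentiableOn_of_mem_exactVanishing hD f.2) v hvf
  exact ⟨k, hk, fun g hg u hug => hkf ⟨g, hg⟩ u hug⟩

omit hμ in
theorem IsKernelClass.mem_derivClasses_succ_iff {k : Lp ℂ 2 (weightedArea D μ)}
    (hk : IsKernelClass D μ m ζ k) {u : Lp ℂ 2 (weightedArea D μ)} :
    u ∈ derivClasses D μ (m + 1) ζ ↔ u ∈ derivClasses D μ m ζ ∧ inner ℂ k u = 0 := by
  have hsucc : ∀ g, g ∈ exactVanishing D (m + 1) ζ ↔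
      g ∈ exactVanishing D m ζ ∧ iteratedDeriv m g ζ = 0 := fun g => by
    simp only [mem_exactVanishing_iff hD hζ, Nat.forall_lt_succ_right, and_assoc]
  constructor
  · rintro ⟨g, hg, hug⟩
    obtain ⟨hgm, hg0⟩ := (hsucc g).1 hg
    exact ⟨⟨g, hgm, hug⟩, (hk.inner_eq g hgm u hug).trans hg0⟩
  · rintro ⟨⟨g, hg, hug⟩, hku⟩
    exact ⟨g, (hsucc g).2 ⟨hg, (hk.inner_eq g hg u hug).symm.trans hku⟩, hug⟩

end KernelClasses

section Existence

variable {D : Set ℂ} {μ : ℂ → ℝ} {ζ : ℂ} (hμ : AdmissibleWeight D μ) (hD : IsPlanarDomain D)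
  (hζ : ζ ∈ D)
include hμ hD hζ

namespace AdmissibleWeight

theorem isClosed_derivClasses_zero :
    IsClosed (derivClasses D μ 0 ζ : Set (Lp ℂ 2 (weightedArea D μ))) := by
  refine IsSeqClosed.isClosed fun v v₀ hv hlim => ?_
  choose f hf hvf using hv
  choose F hFζ hF hFf using fun k => exists_deriv_eqOn_of_mem_exactVanishing (hf k)
  obtain ⟨P, -, hP, hvP, -⟩ := hμ.exists_tendstoLocallyUniformlyOn_of_deriv hD hζ
    (Eventually.of_forall hF) (Eventually.of_forall fun k => (hvf k).trans
      (ae_weightedArea_of_forall_mem hD.1.measurableSet fun z hz => (hFf k hz).symm)) hlim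
    (tendsto_const_nhds.congr fun k => (hFζ k).symm)
  exact ⟨deriv P, deriv_mem_exactVanishing_zero hD.1 hP, hvP⟩

theorem isClosed_derivClasses (m : ℕ) :
    IsClosed (derivClasses D μ m ζ : Set (Lp ℂ 2 (weightedArea D μ))) := by
  induction m with
  | zero => exact hμ.isClosed_derivClasses_zero hD hζ
  | succ m ih =>
    obtain ⟨k, hk⟩ := hμ.exists_isKernelClass_of_isClosed hD.1 hζ ih
    refine (congrArg IsClosed ?_).mp (ih.inter (innerSL ℂ k).isClosed_ker)
    ext u
    symm
    exact hk.mem_derivClasses_succ_iff hD.1 hζ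

theorem hasOrthogonalProjection_derivClasses (m : ℕ) :
    (derivClasses D μ m ζ).HasOrthogonalProjection :=
  have : CompleteSpace (derivClasses D μ m ζ) :=
    (hμ.isClosed_derivClasses hD hζ m).completeSpace_coe
  inferInstance

theorem exists_isKernelClass (m : ℕ) : ∃ k, IsKernelClass D μ m ζ k :=
  hμ.exists_isKernelClass_of_isClosed hD.1 hζ (hμ.isClosed_derivClasses hD hζ m)

end AdmissibleWeight

end Existence

section KernelFunctions

variable {D : Set ℂ} {μ : ℂ → ℝ} {m : ℕ} {ζ : ℂ}

theorem mem_exactVanishing_of_eqOn (hD : IsOpen D) (hζ : ζ ∈ D) {f g : ℂ → ℂ}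
    (hfg : Set.EqOn f g D) (hf : f ∈ exactVanishing D m ζ) : g ∈ exactVanishing D m ζ :=
  ⟨hf.1.imp fun _ hF z hz => hfg hz ▸ hF z hz,
    hf.2.trans_eq (analyticOrderAt_congr (hfg.eventuallyEq_of_mem (hD.mem_nhds hζ)))⟩

theorem inner_eq_adInner (hD : IsOpen D) (hμ : AdmissibleWeight D μ)
    {u v : Lp ℂ 2 (weightedArea D μ)} {F G : ℂ → ℂ} (hu : u =ᵐ[weightedArea D μ] deriv F)
    (hv : v =ᵐ[weightedArea D μ] deriv G) : inner ℂ u v = adInner D μ G F :=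
  inner_eq_setIntegral hD.measurableSet hμ.measurable (fun z hz => (hμ.pos z hz).le) hu hv

theorem isKernelFunction_succ_iff (hD : IsOpen D) (hζ : ζ ∈ D) (hμ : AdmissibleWeight D μ)
    {M : ℂ → ℂ} : IsKernelFunction D μ (m + 1) ζ M ↔ DifferentiableOn ℂ M D ∧ M ζ = 0 ∧
      ∃ k, IsKernelClass D μ m ζ k ∧ k =ᵐ[weightedArea D μ] deriv M := by
  constructor
  · rintro ⟨hMad, hrepr⟩
    obtain ⟨hM, hM0, hM', hL⟩ := (hμ.mem_adSpace_succ_iff hD hζ).1 hMad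
    refine ⟨hM, hM0, hL.toLp, ⟨⟨_, hM', hL.coeFn_toLp⟩, fun g hg u hug => ?_⟩, hL.coeFn_toLp⟩
    obtain ⟨F, hF0, hF, hFg⟩ := exists_deriv_eqOn_of_mem_exactVanishing hg
    have huF : u =ᵐ[weightedArea D μ] deriv F :=
      hug.trans (ae_weightedArea_of_forall_mem hD.measurableSet fun z hz => (hFg hz).symm)
    have hFad : F ∈ adSpace D μ (m + 1) ζ := (hμ.mem_adSpace_succ_iff hD hζ).2
      ⟨hF, hF0, mem_exactVanishing_of_eqOn hD hζ hFg.symm hg, (memLp_congr_ae huF).1 (Lp.memLp u)⟩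
    rw [inner_eq_adInner hD hμ hL.coeFn_toLp huF, ← hrepr F hFad, iteratedDeriv_succ']
    exact (hFg.eventuallyEq_of_mem (hD.mem_nhds hζ)).iteratedDeriv_eq m
  · rintro ⟨hM, hM0, k, ⟨⟨g, hg, hkg⟩, hk⟩, hkM⟩
    have hgM : Set.EqOn g (deriv M) D := hμ.eqOn_of_ae_eq hD
      (differentiableOn_of_mem_exactVanishing hD hg) (hM.deriv hD) (hkg.symm.trans hkM)
    refine ⟨(hμ.mem_adSpace_succ_iff hD hζ).2 ⟨hM, hM0, mem_exactVanishing_of_eqOn hD hζ hgM hg,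
      (memLp_congr_ae hkM).1 (Lp.memLp k)⟩, fun F hF => ?_⟩
    obtain ⟨-, -, hF', hL⟩ := (hμ.mem_adSpace_succ_iff hD hζ).1 hF
    rw [iteratedDeriv_succ', ← hk _ hF' _ hL.coeFn_toLp, inner_eq_adInner hD hμ hkM hL.coeFn_toLp]

theorem IsKernelClass.eq_projAdjoint {D' : Set ℂ} {μ' : ℂ → ℝ} (hD : MeasurableSet D)
    (hDD' : D ⊆ D') (hμμ' : ∀ z ∈ D, μ z ≤ μ' z) {k : Lp ℂ 2 (weightedArea D μ)}
    {k' : Lp ℂ 2 (weightedArea D' μ')} [(derivClasses D' μ' m ζ).HasOrthogonalProjection]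
    (hk : IsKernelClass D μ m ζ k) (hk' : IsKernelClass D' μ' m ζ k') :
    k' = projAdjoint (l2Restrict (weightedArea D μ) (weightedArea D' μ'))
      (derivClasses D' μ' m ζ) k := by
  have hle : weightedArea D μ ≤ weightedArea D' μ' := weightedArea_mono hD hDD' hμμ'
  refine ReducedBergman.eq_projAdjoint hk'.mem fun u ⟨f, hf, huf⟩ => ?_
  rw [hk'.inner_eq f hf u huf, hk.inner_eq f (exactVanishing_mono hDD' hf) _
    ((coeFn_l2Restrict hle u).trans (huf.filter_mono (ae_mono hle)))]

theorem IsKernelClass.ext {k k' : Lp ℂ 2 (weightedArea D μ)} (hk : IsKernelClass D μ m ζ k)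
    (hk' : IsKernelClass D μ m ζ k') : k = k' := by
  have hsub : k - k' ∈ derivClasses D μ m ζ := Submodule.sub_mem _ hk.mem hk'.mem
  obtain ⟨f, hf, hkf⟩ := hsub
  rw [← sub_eq_zero, ← inner_self_eq_zero (𝕜 := ℂ), inner_sub_left, hk.inner_eq f hf _ hkf,
    hk'.inner_eq f hf _ hkf, sub_self]

variable (hD : IsPlanarDomain D) (hζ : ζ ∈ D) (hμ : AdmissibleWeight D μ)
include hD hζ hμ

theorem isKernelFunction_kernelM (m : ℕ) :
    IsKernelFunction D μ (m + 1) ζ (kernelM D μ (m + 1) ζ) := by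
  have hex : ∃ M, IsKernelFunction D μ (m + 1) ζ M := by
    obtain ⟨k, hk⟩ := hμ.exists_isKernelClass hD hζ m
    obtain ⟨g, hg, hkg⟩ := hk.mem
    obtain ⟨M, hM0, hM, hMg⟩ := exists_deriv_eqOn_of_mem_exactVanishing hg
    exact ⟨M, (isKernelFunction_succ_iff hD.1 hζ hμ).2 ⟨hM, hM0, k, hk,
      hkg.trans (ae_weightedArea_of_forall_mem hD.1.measurableSet fun z hz => (hMg hz).symm)⟩⟩
  rw [kernelM, dif_pos hex]
  exact hex.choose_spec

theorem kernelM_spec (m : ℕ) : DifferentiableOn ℂ (kernelM D μ (m + 1) ζ) D ∧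
    kernelM D μ (m + 1) ζ ζ = 0 ∧ ∃ k, IsKernelClass D μ m ζ k ∧
      k =ᵐ[weightedArea D μ] deriv (kernelM D μ (m + 1) ζ) :=
  (isKernelFunction_succ_iff hD.1 hζ hμ).1 (isKernelFunction_kernelM hD hζ hμ m)

theorem IsKernelFunction.eqOn {M M' : ℂ → ℂ} (hM : IsKernelFunction D μ (m + 1) ζ M)
    (hM' : IsKernelFunction D μ (m + 1) ζ M') : Set.EqOn M M' D := by
  obtain ⟨hMD, hM0, k, hk, hkM⟩ := (isKernelFunction_succ_iff hD.1 hζ hμ).1 hM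
  obtain ⟨hMD', hM0', k', hk', hkM'⟩ := (isKernelFunction_succ_iff hD.1 hζ hμ).1 hM'
  obtain rfl := hk.ext hk'
  exact hD.1.eqOn_of_deriv_eq hD.2.isPreconnected hMD hMD'
    (hμ.eqOn_of_ae_eq hD.1 (hMD.deriv hD.1) (hMD'.deriv hD.1) (hkM.symm.trans hkM')) hζ
    (hM0.trans hM0'.symm)

theorem reducedKernel_one_self_eq_norm_sq {k : Lp ℂ 2 (weightedArea D μ)}
    (hk : IsKernelClass D μ 0 ζ k) : reducedKernel D μ 1 ζ ζ = ((‖k‖ ^ 2 : ℝ) : ℂ) := by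
  obtain ⟨hM, -, k', hk', hkM⟩ := kernelM_spec hD hζ hμ 0
  obtain rfl := hk.ext hk'
  have hrepr := hk.inner_eq _ (deriv_mem_exactVanishing_zero hD.1 hM) k hkM
  rw [inner_self_eq_norm_sq_to_K, iteratedDeriv_zero] at hrepr
  rw [reducedKernel, ← hrepr, RCLike.ofReal_eq_complex_ofReal, Complex.ofReal_pow]

end KernelFunctions

section Intersections

variable {D : Set ℂ} {μ : ℂ → ℝ} {ζ : ℂ} {k : Lp ℂ 2 (weightedArea D μ)}

theorem exactVanishing_zero_eq (D : Set ℂ) (ζ ξ : ℂ) :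
    exactVanishing D 0 ζ = exactVanishing D 0 ξ :=
  Submodule.ext fun _ => mem_exactVanishing_zero_iff.trans mem_exactVanishing_zero_iff.symm

theorem IsKernelClass.zero_mem_derivClasses (hk : IsKernelClass D μ 0 ζ k) (ξ : ℂ) :
    k ∈ derivClasses D μ 0 ξ := by
  rw [derivClasses, exactVanishing_zero_eq D ξ ζ]
  exact hk.mem

variable (hD : IsPlanarDomain D) (hμ : AdmissibleWeight D μ)
include hD hμ

theorem derivClasses_zero_le_topologicalClosure_span (hζ : ζ ∈ D) :
    derivClasses D μ 0 ζ ≤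
      (Submodule.span ℂ {k | ∃ t ∈ D, IsKernelClass D μ 0 t k}).topologicalClosure := by
  refine le_topologicalClosure_span (hμ.isClosed_derivClasses hD hζ 0) ?_ ?_
  · rintro k ⟨t, -, hk⟩
    exact hk.zero_mem_derivClasses ζ
  · rintro v ⟨f, hf, hvf⟩ horth
    have hf0 : ∀ t ∈ D, f t = 0 := fun t ht => by
      obtain ⟨k, hk⟩ := hμ.exists_isKernelClass hD ht 0
      rw [← iteratedDeriv_zero (𝕜 := ℂ) (f := f), ← horth k ⟨t, ht, hk⟩,
        hk.inner_eq f (exactVanishing_zero_eq D ζ t ▸ hf) v hvf]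
    exact (Lp.eq_zero_iff_ae_eq_zero).2 (hvf.trans
      (ae_weightedArea_of_forall_mem hD.1.measurableSet hf0))

variable {ι : Type*} {l : Filter ι} {Ω : ι → Set ℂ} {w : ι → ℂ → ℝ}
  (hΩ : ∀ i, IsPlanarDomain (Ω i)) (hw : ∀ i, AdmissibleWeight (Ω i) (w i))
  (hDΩ : ∀ i, D ⊆ Ω i) (hμw : ∀ i, ∀ z ∈ D, μ z ≤ w i z)
  (hdiag : ∀ t ∈ D, Tendsto (fun i => reducedKernel (Ω i) (w i) 1 t t) l
    (𝓝 (reducedKernel D μ 1 t t)))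
include hΩ hw hDΩ hμw hdiag

theorem tendsto_l2Restrict_projAdjoint_of_isKernelClass_zero
    [∀ i, (derivClasses (Ω i) (w i) 0 ζ).HasOrthogonalProjection] (hζ : ζ ∈ D)
    (hk : IsKernelClass D μ 0 ζ k) :
    Tendsto (fun i => l2Restrict (weightedArea D μ) (weightedArea (Ω i) (w i))
      (projAdjoint (l2Restrict (weightedArea D μ) (weightedArea (Ω i) (w i)))
        (derivClasses (Ω i) (w i) 0 ζ) k)) l (𝓝 k) := by
  refine tendsto_map_projAdjoint_of_tendsto_norm_sq
    (fun i => norm_l2Restrict_le_one (weightedArea D μ) (weightedArea (Ω i) (w i))) ?_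
  choose κ hκ using fun i => (hw i).exists_isKernelClass (hΩ i) (hDΩ i hζ) 0
  have hnorm := hdiag ζ hζ
  simp only [reducedKernel_one_self_eq_norm_sq hD hζ hμ hk,
    reducedKernel_one_self_eq_norm_sq (hΩ _) (hDΩ _ hζ) (hw _) (hκ _)] at hnorm
  have hκk := fun i => hk.eq_projAdjoint hD.1.measurableSet (hDΩ i) (hμw i) (hκ i)
  simp only [hκk] at hnorm
  exact tendsto_ofReal_iff.1 hnorm

theorem tendsto_l2Restrict_projAdjoint
    [∀ m i, (derivClasses (Ω i) (w i) m ζ).HasOrthogonalProjection] (hζ : ζ ∈ D) (m : ℕ)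
    {v : Lp ℂ 2 (weightedArea D μ)} (hv : v ∈ derivClasses D μ m ζ) :
    Tendsto (fun i => l2Restrict (weightedArea D μ) (weightedArea (Ω i) (w i))
      (projAdjoint (l2Restrict (weightedArea D μ) (weightedArea (Ω i) (w i)))
        (derivClasses (Ω i) (w i) m ζ) v)) l (𝓝 v) := by
  induction m generalizing v with
  | zero =>
    refine tendsto_map_projAdjoint_of_mem_topologicalClosure_span
      (fun i => norm_l2Restrict_le_one (weightedArea D μ) (weightedArea (Ω i) (w i))) ?_
      (derivClasses_zero_le_topologicalClosure_span hD hμ hζ hv)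
    rintro k ⟨t, ht, hk⟩
    have hbase : ∀ i, derivClasses (Ω i) (w i) 0 ζ = derivClasses (Ω i) (w i) 0 t := fun i =>
      congrArg (l2Classes · _) (exactVanishing_zero_eq (Ω i) ζ t)
    have := fun i => (hw i).hasOrthogonalProjection_derivClasses (hΩ i) (hDΩ i ht) 0
    simpa only [hbase] using
      tendsto_l2Restrict_projAdjoint_of_isKernelClass_zero hD hμ hΩ hw hDΩ hμw hdiag ht hk
  | succ m ih =>
    obtain ⟨k, hk⟩ := hμ.exists_isKernelClass hD hζ m
    obtain ⟨hvm, hkv⟩ := (hk.mem_derivClasses_succ_iff hD.1 hζ).1 hv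
    refine tendsto_map_projAdjoint_of_inner_eq_zero (k := k) (fun i u => ?_) (ih hk.mem) (ih hvm)
      hkv
    obtain ⟨κ, hκ⟩ := (hw i).exists_isKernelClass (hΩ i) (hDΩ i hζ) m
    rw [← hk.eq_projAdjoint hD.1.measurableSet (hDΩ i) (hμw i) hκ]
    exact hκ.mem_derivClasses_succ_iff (hΩ i).1 (hDΩ i hζ)

theorem tendstoLocallyUniformlyOn_kernelM_of_tendsto_reducedKernel [l.NeBot] (hζ : ζ ∈ D) (m : ℕ) :
    TendstoLocallyUniformlyOn (fun i => kernelM (Ω i) (w i) (m + 1) ζ) (kernelM D μ (m + 1) ζ)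
      l D := by
  have := fun m i => (hw i).hasOrthogonalProjection_derivClasses (hΩ i) (hDΩ i hζ) m
  obtain ⟨hM, hM0, k, hk, hkM⟩ := kernelM_spec hD hζ hμ m
  choose hMi hMi0 κ hκ hκM using fun i => kernelM_spec (hΩ i) (hDΩ i hζ) (hw i) m
  have hlim := tendsto_l2Restrict_projAdjoint hD hμ hΩ hw hDΩ hμw hdiag hζ m hk.mem
  simp only [← hk.eq_projAdjoint hD.1.measurableSet (hDΩ _) (hμw _) (hκ _)] at hlim
  have hle := fun i => weightedArea_mono hD.1.measurableSet (hDΩ i) (hμw i)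
  exact hμ.tendstoLocallyUniformlyOn_of_deriv hD hζ
    (Eventually.of_forall fun i => (hMi i).mono (hDΩ i))
    (Eventually.of_forall fun i =>
      (coeFn_l2Restrict (hle i) (κ i)).trans ((hκM i).filter_mono (ae_mono (hle i))))
    hlim hM hkM (by simpa only [hMi0, hM0] using tendsto_const_nhds)

end Intersections

section IncreasingDomains

variable {ι : Type*} {l : Filter ι}

theorem tendsto_iteratedDeriv_of_tendstoLocallyUniformlyOn {D : Set ℂ} (hD : IsOpen D)
    {F : ι → ℂ → ℂ} {f : ℂ → ℂ} (hF : ∀ᶠ k in l, DifferentiableOn ℂ (F k) D)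
    (hlim : TendstoLocallyUniformlyOn F f l D) (n : ℕ) {z : ℂ} (hz : z ∈ D) :
    Tendsto (fun k => iteratedDeriv n (F k) z) l (𝓝 (iteratedDeriv n f z)) := by
  induction n generalizing F f with
  | zero => simpa only [iteratedDeriv_zero] using hlim.tendsto_at hz
  | succ n ih =>
    simpa only [iteratedDeriv_succ'] using
      ih (hF.mono fun k hk => hk.deriv hD) (hlim.deriv hF hD)

variable [l.NeBot]

theorem exists_tendsto_norm_sq_and_tendsto_l2Restrict {α : Type*} [MeasurableSpace α]
    {ν : ι → Measure α} {κ : ∀ i, Lp ℂ 2 (ν i)} (hν : ∀ i, ∀ᶠ k in l, ν i ≤ ν k)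
    (hκ : ∀ᶠ j in l, ∀ᶠ k in l,
      ‖l2Restrict (ν j) (ν k) (κ k) - κ j‖ ^ 2 ≤ ‖κ j‖ ^ 2 - ‖κ k‖ ^ 2) :
    ∃ r, Tendsto (fun k => ‖κ k‖ ^ 2) l (𝓝 r) ∧
      ∀ i, ∃ x, Tendsto (fun k => l2Restrict (ν i) (ν k) (κ k)) l (𝓝 x) := by
  obtain ⟨r, hr, hrκ⟩ := exists_tendsto_of_eventually_eventually_le (l := l)
    (a := fun k => ‖κ k‖ ^ 2) (fun k => sq_nonneg _) (hκ.mono fun j hj => hj.mono fun k hk =>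
      sub_nonneg.1 ((sq_nonneg _).trans hk))
  refine ⟨r, hr, fun i => exists_tendsto_of_eventually_dist_lt fun ε hε => ?_⟩
  obtain ⟨j, hij, hj, hjr⟩ := ((hν i).and (hκ.and
    (hr.eventually_lt_const (lt_add_of_pos_right r (sq_pos_of_pos hε))))).exists
  refine ⟨l2Restrict (ν i) (ν j) (κ j), ?_⟩
  filter_upwards [hj, hν j, hrκ] with k hjk hνjk hrk
  refine lt_of_pow_lt_pow_left₀ 2 hε.le ?_
  calc dist (l2Restrict (ν i) (ν k) (κ k)) (l2Restrict (ν i) (ν j) (κ j)) ^ 2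
      = ‖l2Restrict (ν i) (ν j) (l2Restrict (ν j) (ν k) (κ k) - κ j)‖ ^ 2 := by
        rw [map_sub, l2Restrict_l2Restrict hij hνjk, dist_eq_norm]
    _ ≤ ‖l2Restrict (ν j) (ν k) (κ k) - κ j‖ ^ 2 := by gcongr; exact norm_l2Restrict_le _
    _ < ε ^ 2 := by linarith

theorem IsPlanarDomain.iUnion_of_directed [Nonempty ι] {Ω : ι → Set ℂ}
    (hΩ : ∀ i, IsPlanarDomain (Ω i)) (hdir : Directed (· ⊆ ·) Ω) : IsPlanarDomain (⋃ i, Ω i) :=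
  ⟨isOpen_iUnion fun i => (hΩ i).1,
    Set.nonempty_iUnion.2 ⟨Classical.arbitrary ι, (hΩ _).2.nonempty⟩,
    IsPreconnected.sUnion_directed hdir.directedOn_range
      (Set.forall_mem_range.2 fun i => (hΩ i).2.isPreconnected)⟩

theorem IsKernelClass.norm_l2Restrict_sub_sq_le {D D' : Set ℂ} {μ μ' : ℂ → ℝ} {m : ℕ} {ζ : ℂ}
    (hD : MeasurableSet D) (hD' : IsPlanarDomain D') (hμ' : AdmissibleWeight D' μ') (hζ : ζ ∈ D)
    (hDD' : D ⊆ D') (hμμ' : ∀ z ∈ D, μ z ≤ μ' z) {k : Lp ℂ 2 (weightedArea D μ)}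
    {k' : Lp ℂ 2 (weightedArea D' μ')} (hk : IsKernelClass D μ m ζ k)
    (hk' : IsKernelClass D' μ' m ζ k') :
    ‖l2Restrict (weightedArea D μ) (weightedArea D' μ') k' - k‖ ^ 2 ≤ ‖k‖ ^ 2 - ‖k'‖ ^ 2 := by
  have := hμ'.hasOrthogonalProjection_derivClasses hD' (hDD' hζ) m
  rw [hk.eq_projAdjoint hD hDD' hμμ' hk']
  exact norm_map_projAdjoint_sub_sq_le (norm_l2Restrict_le_one _ _) k

variable {Ω : ι → Set ℂ} {w : ι → ℂ → ℝ} {m : ℕ} {ζ : ℂ}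
  (hΩ : ∀ i, IsPlanarDomain (Ω i)) (hw : ∀ i, AdmissibleWeight (Ω i) (w i))
  (hmono : ∀ i, ∀ᶠ k in l, Ω i ⊆ Ω k ∧ ∀ z ∈ Ω i, w i z ≤ w k z)
  (hζ : ∀ᶠ k in l, ζ ∈ Ω k)
include hΩ hw hmono hζ

theorem exists_tendstoLocallyUniformlyOn_kernelM {κ : ∀ i, Lp ℂ 2 (weightedArea (Ω i) (w i))}
    (hκ : ∀ i, ζ ∈ Ω i → IsKernelClass (Ω i) (w i) m ζ (κ i))
    (hκM : ∀ i, ζ ∈ Ω i → κ i =ᵐ[weightedArea (Ω i) (w i)] deriv (kernelM (Ω i) (w i) (m + 1) ζ)) :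
    ∃ r g, Tendsto (fun k => ‖κ k‖ ^ 2) l (𝓝 r) ∧ ∀ i, ζ ∈ Ω i →
      DifferentiableOn ℂ g (Ω i) ∧
      TendstoLocallyUniformlyOn (fun k => kernelM (Ω k) (w k) (m + 1) ζ) g l (Ω i) ∧
      ∃ x : Lp ℂ 2 (weightedArea (Ω i) (w i)), x =ᵐ[weightedArea (Ω i) (w i)] deriv g ∧
        ‖x‖ ^ 2 ≤ r := by
  set M := fun k => kernelM (Ω k) (w k) (m + 1) ζ
  have hM : ∀ᶠ k in l, DifferentiableOn ℂ (M k) (Ω k) ∧ M k ζ = 0 := hζ.mono fun k hk =>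
    ⟨(kernelM_spec (hΩ k) hk (hw k) m).1, (kernelM_spec (hΩ k) hk (hw k) m).2.1⟩
  have hle : ∀ i, ∀ᶠ k in l, weightedArea (Ω i) (w i) ≤ weightedArea (Ω k) (w k) := fun i =>
    (hmono i).mono fun k hk => weightedArea_mono (hΩ i).1.measurableSet hk.1 hk.2
  obtain ⟨r, hr, hx⟩ := exists_tendsto_norm_sq_and_tendsto_l2Restrict hle
    (hζ.mono fun j hj => (hmono j).mono fun k hk => (hκ j hj).norm_l2Restrict_sub_sq_le
      (hΩ j).1.measurableSet (hΩ k) (hw k) hj hk.1 hk.2 (hκ k (hk.1 hj)))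
  choose x hx using hx
  have hlocal : ∀ i, ζ ∈ Ω i → ∃ P, DifferentiableOn ℂ P (Ω i) ∧
      x i =ᵐ[weightedArea (Ω i) (w i)] deriv P ∧ TendstoLocallyUniformlyOn M P l (Ω i) := by
    intro i hi
    obtain ⟨P, -, hP⟩ := (hw i).exists_tendstoLocallyUniformlyOn_of_deriv (hΩ i) hi
      ((hM.and (hmono i)).mono fun k hk => hk.1.1.mono hk.2.1)
      (((hle i).and hζ).mono fun k ⟨hk, hkζ⟩ =>
        (coeFn_l2Restrict hk (κ k)).trans ((hκM k hkζ).filter_mono (ae_mono hk)))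
      (hx i) (tendsto_const_nhds.congr' (hM.mono fun k hk => hk.2.symm))
    exact ⟨P, hP⟩
  choose! P hP hxP hMP using hlocal
  have hlim : ∀ z, ∃ c, ∀ i, ζ ∈ Ω i → z ∈ Ω i → P i z = c := fun z => by
    by_cases h : ∃ c, Tendsto (fun k => M k z) l (𝓝 c)
    · exact h.imp fun c hc i hi hz => tendsto_nhds_unique ((hMP i hi).tendsto_at hz) hc
    · exact ⟨0, fun i hi hz => (h ⟨_, (hMP i hi).tendsto_at hz⟩).elim⟩
  choose g hg using hlim
  refine ⟨r, g, hr, fun i hi => ⟨(hP i hi).congr fun z hz => (hg z i hi hz).symm,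
    (hMP i hi).congr_right fun z hz => hg z i hi hz, x i, (hxP i hi).trans
      (ae_weightedArea_of_forall_mem (hΩ i).1.measurableSet fun z hz => ?_), ?_⟩⟩
  · refine EventuallyEq.deriv_eq ?_
    filter_upwards [(hΩ i).1.mem_nhds hz] with y hy using hg y i hi hy
  · exact le_of_tendsto_of_tendsto' ((hx i).norm.pow 2) hr fun k => by
      gcongr
      exact norm_l2Restrict_le _

end IncreasingDomains

section Unions

theorem IsKernelFunction.iteratedDeriv_eq_norm_sq {D : Set ℂ} {μ : ℂ → ℝ} {n : ℕ} {ζ : ℂ}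
    (hD : IsOpen D) (hμ : AdmissibleWeight D μ) {M : ℂ → ℂ} (hM : IsKernelFunction D μ n ζ M)
    {k : Lp ℂ 2 (weightedArea D μ)} (hkM : k =ᵐ[weightedArea D μ] deriv M) :
    iteratedDeriv n M ζ = ((‖k‖ ^ 2 : ℝ) : ℂ) := by
  rw [hM.2 M hM.1, ← inner_eq_adInner hD hμ hkM hkM, inner_self_eq_norm_sq_to_K,
    RCLike.ofReal_eq_complex_ofReal, Complex.ofReal_pow]

theorem IsKernelClass.eq_of_norm_sq_le {D : Set ℂ} {μ : ℂ → ℝ} {m : ℕ} {ζ : ℂ}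
    {k x : Lp ℂ 2 (weightedArea D μ)} (hk : IsKernelClass D μ m ζ k) {g : ℂ → ℂ}
    (hg : g ∈ exactVanishing D m ζ) (hxg : x =ᵐ[weightedArea D μ] g) {r : ℝ}
    (hgr : iteratedDeriv m g ζ = r) (hx : ‖x‖ ^ 2 ≤ r) (hkr : ‖k‖ ^ 2 ≤ r) : k = x := by
  have hkx : inner ℂ k x = (r : ℂ) := (hk.inner_eq g hg x hxg).trans hgr
  have hsq : ‖k - x‖ ^ 2 = ‖k‖ ^ 2 - 2 * r + ‖x‖ ^ 2 := by
    rw [norm_sub_sq (𝕜 := ℂ), hkx, RCLike.re_eq_complex_re, Complex.ofReal_re]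
  exact sub_eq_zero.1 (norm_eq_zero.1 (sq_eq_zero_iff.1
    ((sq_nonneg ‖k - x‖).antisymm' (by linarith))))

variable {ι : Type*} {l : Filter ι} {Ω : ι → Set ℂ} {w : ι → ℂ → ℝ} {μ : ℂ → ℝ} {ζ : ℂ}

theorem eventually_mem_of_mem_iUnion {z : ℂ} (hΩ : ∀ i, ∀ᶠ k in l, Ω i ⊆ Ω k)
    (hz : z ∈ ⋃ i, Ω i) : ∀ᶠ k in l, z ∈ Ω k :=
  have ⟨i, hi⟩ := Set.mem_iUnion.1 hz
  (hΩ i).mono fun _ hk => hk hi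

theorem exists_ae_eq_norm_sq_le_iUnion [l.NeBot] [l.IsCountablyGenerated]
    (hΩ : ∀ i, IsOpen (Ω i)) (hw : ∀ i, AEMeasurable (w i) (volume.restrict (Ω i)))
    (hμ : AEMeasurable μ (volume.restrict (⋃ i, Ω i))) (hmono : ∀ i, ∀ᶠ k in l, Ω i ⊆ Ω k)
    (hlim : ∀ᵐ z ∂volume.restrict (⋃ i, Ω i), Tendsto (fun i => w i z) l (𝓝 (μ z)))
    {r : ℝ} {f : ℂ → ℂ} (hf : DifferentiableOn ℂ f (⋃ i, Ω i))
    (hfr : ∀ᶠ i in l, ∃ x : Lp ℂ 2 (weightedArea (Ω i) (w i)),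
      x =ᵐ[weightedArea (Ω i) (w i)] f ∧ ‖x‖ ^ 2 ≤ r) :
    ∃ x : Lp ℂ 2 (weightedArea (⋃ i, Ω i) μ),
      x =ᵐ[weightedArea (⋃ i, Ω i) μ] f ∧ ‖x‖ ^ 2 ≤ r := by
  have hD : IsOpen (⋃ i, Ω i) := isOpen_iUnion hΩ
  have hfm := aestronglyMeasurable_of_differentiableOn hD hf
  have hr : 0 ≤ r := by
    obtain ⟨i, x, -, hx⟩ := hfr.exists
    exact (sq_nonneg _).trans hx
  have hle : eLpNorm f 2 (weightedArea (⋃ i, Ω i) μ) ≤ ENNReal.ofReal √r := by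
    refine eLpNorm_two_weightedArea_le_of_tendsto (fun i => (hΩ i).measurableSet) hw hμ
      hD.measurableSet (Set.subset_iUnion Ω) (fun z => eventually_mem_of_mem_iUnion hmono) hlim hfm
      (hfr.mono ?_)
    rintro i ⟨x, hxf, hx⟩
    rw [← eLpNorm_congr_ae hxf, ← Lp.enorm_def, ← ofReal_norm]
    exact ENNReal.ofReal_le_ofReal (Real.le_sqrt_of_sq_le hx)
  have hL : MemLp f 2 (weightedArea (⋃ i, Ω i) μ) :=
    ⟨hfm.mono_ac (weightedArea_absolutelyContinuous _ _), hle.trans_lt ENNReal.ofReal_lt_top⟩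
  refine ⟨hL.toLp, hL.coeFn_toLp, ?_⟩
  rw [← Real.le_sqrt (norm_nonneg _) hr, Lp.norm_toLp]
  exact ENNReal.toReal_le_of_le_ofReal (Real.sqrt_nonneg _) hle

variable [l.NeBot] (hΩ : ∀ i, IsPlanarDomain (Ω i)) (hw : ∀ i, AdmissibleWeight (Ω i) (w i))
include hΩ hw

theorem iteratedDeriv_eq_of_tendstoLocallyUniformlyOn_kernelM {U : Set ℂ} (hU : IsOpen U)
    (hζ : ζ ∈ U) (hUΩ : ∀ᶠ k in l, U ⊆ Ω k) {m : ℕ}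
    {κ : ∀ i, Lp ℂ 2 (weightedArea (Ω i) (w i))}
    (hκM : ∀ i, ζ ∈ Ω i → κ i =ᵐ[weightedArea (Ω i) (w i)] deriv (kernelM (Ω i) (w i) (m + 1) ζ))
    {r : ℝ} (hr : Tendsto (fun k => ‖κ k‖ ^ 2) l (𝓝 r)) {g : ℂ → ℂ}
    (hMg : TendstoLocallyUniformlyOn (fun k => kernelM (Ω k) (w k) (m + 1) ζ) g l U) :
    (∀ j < m + 1, iteratedDeriv j g ζ = 0) ∧ iteratedDeriv (m + 1) g ζ = r := by
  have hM : ∀ᶠ k in l, IsKernelFunction (Ω k) (w k) (m + 1) ζ (kernelM (Ω k) (w k) (m + 1) ζ) :=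
    hUΩ.mono fun k hk => isKernelFunction_kernelM (hΩ k) (hk hζ) (hw k) m
  have hlim := fun n => tendsto_iteratedDeriv_of_tendstoLocallyUniformlyOn hU
    ((hM.and hUΩ).mono fun k hk => hk.1.1.1.mono hk.2) hMg n hζ
  refine ⟨fun j hj => tendsto_nhds_unique (hlim j)
    (tendsto_const_nhds.congr' (hM.mono fun k hk => (hk.1.2.1 j hj).symm)), ?_⟩
  refine tendsto_nhds_unique (hlim (m + 1))
    (((Complex.continuous_ofReal.tendsto r).comp hr).congr' ?_)
  filter_upwards [hM, hUΩ] with k hk hUk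
  exact (hk.iteratedDeriv_eq_norm_sq (hΩ k).1 (hw k) (hκM k (hUk hζ))).symm

variable [l.IsCountablyGenerated] (hμ : AdmissibleWeight (⋃ i, Ω i) μ)
  (hmono : ∀ i, ∀ᶠ k in l, Ω i ⊆ Ω k ∧ ∀ z ∈ Ω i, w i z ≤ w k z ∧ w k z ≤ μ z)
  (hlim : ∀ᵐ z ∂volume.restrict (⋃ i, Ω i), Tendsto (fun i => w i z) l (𝓝 (μ z)))
include hμ hmono hlim

theorem exists_tendstoLocallyUniformlyOn_kernelM_iUnion {m : ℕ}
    (hζ : ∀ᶠ k in l, ζ ∈ Ω k) {κ : ∀ i, Lp ℂ 2 (weightedArea (Ω i) (w i))}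
    (hκ : ∀ i, ζ ∈ Ω i → IsKernelClass (Ω i) (w i) m ζ (κ i))
    (hκM : ∀ i, ζ ∈ Ω i → κ i =ᵐ[weightedArea (Ω i) (w i)] deriv (kernelM (Ω i) (w i) (m + 1) ζ)) :
    ∃ r g, Tendsto (fun k => ‖κ k‖ ^ 2) l (𝓝 r) ∧ DifferentiableOn ℂ g (⋃ i, Ω i) ∧
      TendstoLocallyUniformlyOn (fun k => kernelM (Ω k) (w k) (m + 1) ζ) g l (⋃ i, Ω i) ∧
      ∃ x : Lp ℂ 2 (weightedArea (⋃ i, Ω i) μ),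
        x =ᵐ[weightedArea (⋃ i, Ω i) μ] deriv g ∧ ‖x‖ ^ 2 ≤ r := by
  have hcover : ⋃ i, Ω i ⊆ ⋃ i ∈ {i | ζ ∈ Ω i}, Ω i := fun z hz => by
    obtain ⟨i, hi, hzi⟩ := (hζ.and (eventually_mem_of_mem_iUnion
      (fun i => (hmono i).mono fun _ hk => hk.1) hz)).exists
    exact Set.mem_biUnion hi hzi
  obtain ⟨r, g, hr, hg⟩ := exists_tendstoLocallyUniformlyOn_kernelM hΩ hw
    (fun i => (hmono i).mono fun k hk => ⟨hk.1, fun z hz => (hk.2 z hz).1⟩) hζ hκ hκM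
  have hgD : DifferentiableOn ℂ g (⋃ i, Ω i) := fun z hz => by
    obtain ⟨i, hi, hzi⟩ := Set.mem_iUnion₂.1 (hcover hz)
    exact ((hg i hi).1.differentiableAt ((hΩ i).1.mem_nhds hzi)).differentiableWithinAt
  exact ⟨r, g, hr, hgD, (tendstoLocallyUniformlyOn_biUnion (fun i _ => (hΩ i).1)
    fun i hi => (hg i hi).2.1).mono hcover,
    exists_ae_eq_norm_sq_le_iUnion (fun i => (hΩ i).1) (fun i => (hw i).measurable) hμ.measurable
      (fun i => (hmono i).mono fun _ hk => hk.1) hlim (hgD.deriv (isOpen_iUnion fun i => (hΩ i).1))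
      (hζ.mono fun i hi => (hg i hi).2.2)⟩

theorem tendstoLocallyUniformlyOn_kernelM_iUnion (hζ : ζ ∈ ⋃ i, Ω i) (m : ℕ) :
    TendstoLocallyUniformlyOn (fun k => kernelM (Ω k) (w k) (m + 1) ζ)
      (kernelM (⋃ i, Ω i) μ (m + 1) ζ) l (⋃ i, Ω i) := by
  have : Nonempty ι := l.nonempty_of_neBot
  have hD : IsPlanarDomain (⋃ i, Ω i) := .iUnion_of_directed hΩ fun i j =>
    ((hmono i).and (hmono j)).exists.imp fun _ hk => ⟨hk.1.1, hk.2.1⟩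
  have hζΩ : ∀ᶠ k in l, ζ ∈ Ω k :=
    eventually_mem_of_mem_iUnion (fun i => (hmono i).mono fun _ hk => hk.1) hζ
  have hwμ : ∀ i, ∀ z ∈ Ω i, w i z ≤ μ z := fun i z hz =>
    have ⟨_, _, hk⟩ := (hmono i).exists
    (hk z hz).1.trans (hk z hz).2
  choose! κ hκ hκM using fun i (hi : ζ ∈ Ω i) => (kernelM_spec (hΩ i) hi (hw i) m).2.2
  obtain ⟨r, g, hr, hg, hMg, x, hxg, hx⟩ :=
    exists_tendstoLocallyUniformlyOn_kernelM_iUnion hΩ hw hμ hmono hlim hζΩ hκ hκM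
  obtain ⟨k, hk⟩ := hμ.exists_isKernelClass hD hζ m
  have hkr : ‖k‖ ^ 2 ≤ r := ge_of_tendsto hr <| hζΩ.mono fun i hi =>
    sub_nonneg.1 <| (sq_nonneg _).trans <| (hκ i hi).norm_l2Restrict_sub_sq_le
      (hΩ i).1.measurableSet hD hμ hi (Set.subset_iUnion Ω i) (hwμ i) hk
  obtain ⟨hg0, hgr⟩ : (∀ j < m + 1, iteratedDeriv j g ζ = 0) ∧ iteratedDeriv (m + 1) g ζ = r := by
    obtain ⟨i, hi⟩ := hζΩ.exists
    exact iteratedDeriv_eq_of_tendstoLocallyUniformlyOn_kernelM hΩ hw (hΩ i).1 hi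
      ((hmono i).mono fun _ hk => hk.1) hκM hr (hMg.mono (Set.subset_iUnion Ω i))
  have hgm : deriv g ∈ exactVanishing (⋃ i, Ω i) m ζ := (mem_exactVanishing_iff hD.1 hζ).2
    ⟨⟨g, fun z hz => hg.hasDerivAt (hD.1.mem_nhds hz)⟩, fun j hj => by
      rw [← iteratedDeriv_succ', hg0 _ (Nat.succ_lt_succ hj)]⟩
  rw [iteratedDeriv_succ'] at hgr
  obtain rfl := hk.eq_of_norm_sq_le hgm hxg hgr hx hkr
  refine hMg.congr_right (IsKernelFunction.eqOn hD hζ hμ ((isKernelFunction_succ_iff hD.1 hζ hμ).2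
    ⟨hg, by simpa using hg0 0 m.succ_pos, k, hk, hxg⟩) (isKernelFunction_kernelM hD hζ hμ m))

end Unions

end ReducedBergman

open ReducedBergman in
theorem mainTheorem6_general {ι : Type*} {l : Filter ι} [l.NeBot] [l.IsCountablyGenerated]
    (Ω : ι → Set ℂ) (w : ι → ℂ → ℝ) (D : Set ℂ) (μ : ℂ → ℝ) (hΩ : ∀ i, IsPlanarDomain (Ω i))
    (hw : ∀ i, AdmissibleWeight (Ω i) (w i)) (hμ : AdmissibleWeight D μ) :
    (∀ (G : Set ℂ) (ν : ℂ → ℝ), IsPlanarDomain G → AdmissibleWeight G ν →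
      ∀ n : ℕ, 1 ≤ n → ∀ ζ ∈ G, IsKernelFunction G ν n ζ (kernelM G ν n ζ) ∧
        ∀ M, IsKernelFunction G ν n ζ M → Set.EqOn M (kernelM G ν n ζ) G) ∧
    (D = ⋃ i, Ω i →
      (∀ i, ∀ᶠ k in l, Ω i ⊆ Ω k ∧ ∀ z ∈ Ω i, w i z ≤ w k z ∧ w k z ≤ μ z) →
      (∀ᵐ z ∂volume.restrict D, Tendsto (fun i => w i z) l (𝓝 (μ z))) →
      ∀ n : ℕ, 1 ≤ n → ∀ ξ ∈ D, TendstoLocallyUniformlyOn (fun i => kernelM (Ω i) (w i) n ξ)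
        (kernelM D μ n ξ) l D) ∧
    (IsPlanarDomain D → (∀ i, D ⊆ Ω i) → (∀ i, ∀ z ∈ D, μ z ≤ w i z) →
      (∀ t ∈ D, Tendsto (fun i => reducedKernel (Ω i) (w i) 1 t t) l
        (𝓝 (reducedKernel D μ 1 t t))) →
      ∀ n : ℕ, 1 ≤ n → ∀ ξ ∈ D, TendstoLocallyUniformlyOn (fun i => kernelM (Ω i) (w i) n ξ)
        (kernelM D μ n ξ) l D) := by
  refine ⟨fun G ν hG hν n hn ζ hζ => ?_, ?_, fun hD hDΩ hμw hdiag n hn ξ hξ => ?_⟩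
  · obtain ⟨m, rfl⟩ := Nat.exists_eq_add_of_le' hn
    have hM := isKernelFunction_kernelM hG hζ hν m
    exact ⟨hM, fun M hM' => hM'.eqOn hG hζ hν hM⟩
  · rintro rfl hmono hlim n hn ξ hξ
    obtain ⟨m, rfl⟩ := Nat.exists_eq_add_of_le' hn
    exact tendstoLocallyUniformlyOn_kernelM_iUnion hΩ hw hμ hmono hlim hξ m
  · obtain ⟨m, rfl⟩ := Nat.exists_eq_add_of_le' hn
    exact tendstoLocallyUniformlyOn_kernelM_of_tendsto_reducedKernel hD hμ hΩ hw hDΩ hμw hdiag hξ m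

theorem mainTheorem6 (Ω : ℕ → Set ℂ) (w : ℕ → ℂ → ℝ) (D : Set ℂ) (μ : ℂ → ℝ)
    (hΩ : ∀ i, ReducedBergman.IsPlanarDomain (Ω i))
    (hw : ∀ i, ReducedBergman.AdmissibleWeight (Ω i) (w i))
    (hμ : ReducedBergman.AdmissibleWeight D μ) :
    -- the kernel functions are well defined
    (∀ (G : Set ℂ) (ν : ℂ → ℝ), ReducedBergman.IsPlanarDomain G →
      ReducedBergman.AdmissibleWeight G ν → ∀ n : ℕ, 1 ≤ n → ∀ ζ ∈ G,
        ReducedBergman.IsKernelFunction G ν n ζ (ReducedBergman.kernelM G ν n ζ) ∧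
        ∀ M, ReducedBergman.IsKernelFunction G ν n ζ M →
          Set.EqOn M (ReducedBergman.kernelM G ν n ζ) G) ∧
    -- unions
    (D = ⋃ i, Ω i →
      (∀ i, ∃ j, ∀ k, j ≤ k → Ω i ⊆ Ω k ∧ ∀ z ∈ Ω i, w i z ≤ w k z ∧ w k z ≤ μ z) →
      (∀ᵐ z ∂(volume.restrict D), Tendsto (fun i => w i z) atTop (𝓝 (μ z))) →
      ∀ n : ℕ, 1 ≤ n → ∀ ξ ∈ D,
        TendstoLocallyUniformlyOn (fun i => ReducedBergman.kernelM (Ω i) (w i) n ξ)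
          (ReducedBergman.kernelM D μ n ξ) atTop D) ∧
    -- intersections
    (D = ⋂ i, Ω i → ReducedBergman.IsPlanarDomain D →
      (∀ i, ∀ z ∈ D, μ z ≤ w i z) →
      (∀ᵐ z ∂(volume.restrict D), Tendsto (fun i => w i z) atTop (𝓝 (μ z))) →
      (∀ t ∈ D, Tendsto (fun i => ReducedBergman.reducedKernel (Ω i) (w i) 1 t t) atTop
        (𝓝 (ReducedBergman.reducedKernel D μ 1 t t))) →
      (∀ ξ ∈ D,
        TendstoLocallyUniformlyOn (fun i => ReducedBergman.kernelM (Ω i) (w i) 1 ξ)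
          (ReducedBergman.kernelM D μ 1 ξ) atTop D) ∧
      (∀ n : ℕ, 1 < n → ∀ ξ ∈ D \ ReducedBergman.kernelZeros D μ,
        TendstoLocallyUniformlyOn (fun i => ReducedBergman.kernelM (Ω i) (w i) n ξ)
          (ReducedBergman.kernelM D μ n ξ) atTop D)) := by
  obtain ⟨hkernel, hunion, hinter⟩ :=
    mainTheorem6_general (l := atTop) Ω w D μ hΩ hw hμ
  refine ⟨hkernel, fun hD hmono => hunion hD fun i => eventually_atTop.2 (hmono i),
    fun hD hdom hμw _ hdiag => ?_⟩
  have hlim := hinter hdom (fun i => hD ▸ Set.iInter_subset Ω i) hμw hdiag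
  exact ⟨hlim 1 le_rfl, fun n hn ξ hξ => hlim n hn.le ξ hξ.1⟩
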